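/- Let $h_0=1$, $h_{n+1}=3h_n+1$, and let $T$ be Chacon's classical automorphism of a standard Borel probability space $(X,\mathscr A,\mu)$, obtained by cutting and stacking: Tower $0$ has height $h_0=1$, and Tower $n+1$ (of height $h_{n+1}$) is obtained from Tower $n$ (of height $h_n$) by cutting it into three sub-columns of equal width, adding one spacer above the middle one, and stacking; the levels of the towers generate $\mathscr A$ modulo null sets. Let $\hat T f=f\circ T$ be its Koopman operator on $L^2(\mu)$, and let $\Theta$ be the orthogonal projector of $L^2(\mu)$ onto the constants. All limits of operators are in the weak operator topology. On $\Gamma=\mathbb Z_3=\{0,1,2\}^{\mathbb N}$ with Haar measure $\lambda$, let $Sx=x+1$, let $\phi(x)\in\{0,1\}$ be the first digit of $x\neq(2,2,\dots)$ that differs from $2$, let $\phi^{(m)}(x)=\sum_{i=0}^{m-1}\phi(S^ix)$, and let $$P_m(X)=\sum_{j=0}^m\lambda\bigl(\phi^{(m)}=j\bigr)X^j .$$ Let $(k_j)$ be a sequence of positive integers with $k_j\to+\infty$ such that $\hat T^{-k_j}$ converges weakly to an operator $L$. Expand each $k_j$ by the greedy algorithm along the heights, $$k_j=\alpha_0^jh_{n_j}+\alpha_1^jh_{n_j-1}+\dots+\alpha_{n_j}^jh_0,$$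 where $n_j$ is the largest $n$ with $h_n\le k_j$, and suppose that for every $\ell\ge0$ the digits $\alpha_\ell^j$ (defined as soon as $n_j\ge\ell$) converge to $\alpha_\ell$ as $j\to\infty$. 1. If there exists $r$ such that $\alpha_\ell=2$ for all $\ell>r$, or $\alpha_\ell=0$ for all $\ell>r$, then there exist $m\ge1$ and a sequence of integers $(k'_j)$ such that $\hat T^{-k'_j}$ converges weakly to some operator $L'$ and $$L=\lim_{j\to\infty}\hat T^{-k_j}=P_m(\hat T)\,L'.$$ 2. If there exist infinitely many $\ell$ with $\alpha_\ell\ne2$ and infinitely many $\ell$ with $\alpha_\ell\ne0$, then $L=\Theta$. -/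

import Mathlib

open MeasureTheory Filter Topology Polynomial

namespace Chacon

/-! ### Chacon's automorphism -/

/-- Heights of the towers: `h 0 = 1`, `h (n + 1) = 3 * h n + 1`. -/
def height : ℕ → ℕ
  | 0 => 1
  | n + 1 => 3 * height n + 1

/-- An automorphism `T` of a probability space is (a realization of) Chacon's classical
automorphism if it is obtained by cutting and stacking as follows. `E n` is the base and
`T^i (E n)`, `0 ≤ i < h n`, are the levels of Tower `n`. Tower `n` is cut into three
sub-columns, with bases `E (n + 1)`, `T^(h n) (E (n + 1))` and `T^(2 * h n + 1) (E (n + 1))`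
(the latter two are the images of the tops of the preceding sub-columns, one spacer being
inserted above the middle one), and the stack of them is Tower `n + 1`. Finally the levels of
the towers exhaust the σ-algebra modulo null sets. -/
structure IsChacon {X : Type*} [MeasurableSpace X] (T : X ≃ᵐ X) (μ : Measure X) : Prop where
  measurePreserving : MeasurePreserving T μ μ
  exists_towers : ∃ E : ℕ → Set X,
    (∀ n, MeasurableSet (E n)) ∧
    (∀ n, ∀ i < height n, ∀ j < height n, i ≠ j → Disjoint (T^[i] '' E n) (T^[j] '' E n)) ∧
    (∀ n, E n = E (n + 1) ∪ T^[height n] '' E (n + 1) ∪ T^[2 * height n + 1] '' E (n + 1)) ∧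
    (∀ A : Set X, MeasurableSet A → ∀ ε > 0, ∃ n, ∃ s ⊆ Finset.range (height n),
      μ (symmDiff A (⋃ i ∈ s, T^[i] '' E n)) < ε)

/-! ### Operators on `L²` -/

/-- The Koopman operator `f ↦ f ∘ T` of an automorphism, as a unitary operator on `L²(μ)`. -/
noncomputable def koopman {X : Type*} [MeasurableSpace X] {μ : Measure X} (T : X ≃ᵐ X)
    (hT : MeasurePreserving T μ μ) : Lp ℂ 2 μ ≃ₗᵢ[ℂ] Lp ℂ 2 μ where
  toFun := Lp.compMeasurePreserving T hT
  invFun := Lp.compMeasurePreserving T.symm (hT.symm T)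
  map_add' f g := map_add _ f g
  map_smul' c f := (Lp.compMeasurePreservingₗ ℂ T hT).map_smul c f
  left_inv f := by
    rw [← Lp.compMeasurePreserving_comp_apply]
    simp
  right_inv f := by
    rw [← Lp.compMeasurePreserving_comp_apply]
    simp
  norm_map' f := Lp.norm_compMeasurePreserving f hT

/-- The power `T̂ ^ n`, `n ∈ ℤ`, of the Koopman operator, as a bounded operator. -/
noncomputable def koopmanPow {X : Type*} [MeasurableSpace X] {μ : Measure X} (T : X ≃ᵐ X)
    (hT : MeasurePreserving T μ μ) (n : ℤ) : Lp ℂ 2 μ →L[ℂ] Lp ℂ 2 μ :=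
  ((koopman T hT ^ n).toContinuousLinearEquiv : Lp ℂ 2 μ →L[ℂ] Lp ℂ 2 μ)

/-- `T̂ ^ (-k j) → L` in the weak operator topology. -/
def IsWeakLimit {X : Type*} [MeasurableSpace X] {μ : Measure X} (T : X ≃ᵐ X)
    (hT : MeasurePreserving T μ μ) (k : ℕ → ℤ) (L : Lp ℂ 2 μ →L[ℂ] Lp ℂ 2 μ) : Prop :=
  Tendsto (fun j => ContinuousLinearMapWOT.ofCLM (koopmanPow T hT (-k j))) atTop
    (𝓝 (ContinuousLinearMapWOT.ofCLM L))

/-- The orthogonal projector of `L²(μ)` onto the constants. -/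
noncomputable def theta {X : Type*} [MeasurableSpace X] (μ : Measure X) [IsFiniteMeasure μ] :
    Lp ℂ 2 μ →L[ℂ] Lp ℂ 2 μ :=
  (Submodule.span ℂ {Lp.const 2 μ (1 : ℂ)}).starProjection

/-! ### The polynomials `P m` -/

/-- The 3-adic group `Γ`, through its sequences of digits. -/
abbrev Gam : Type := ℕ → Fin 3

/-- Haar measure on `Γ`: the digits are i.i.d. and uniformly distributed. -/
noncomputable def haar : Measure Gam :=
  Measure.infinitePi fun _ => ProbabilityTheory.uniformOn (Set.univ : Set (Fin 3))

/-- The adding machine `x ↦ x + 1`: the digit `x i` is increased by `1` modulo `3` exactly if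
a carry reaches it, i.e. if all previous digits are `2`. -/
noncomputable def adding (x : Gam) : Gam := fun i => open Classical in
  if ∀ l < i, x l = 2 then x i + 1 else x i

/-- `φ x` is the first digit of `x` that differs from `2` (and, by convention, `0` at the
single point `222…`). -/
noncomputable def phi (x : Gam) : ℕ := open Classical in
  if h : ∃ i, x i ≠ 2 then (x (Nat.find h)).val else 0

/-- The cocycle `φ^(m) x = φ x + φ (S x) + ⋯ + φ (S^(m-1) x)`. -/
noncomputable def phiSum (m : ℕ) (x : Gam) : ℕ := ∑ i ∈ Finset.range m, phi (adding^[i] x)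

/-- The distribution of `φ^(m)`. -/
noncomputable def dist (m j : ℕ) : ℝ := haar.real {x | phiSum m x = j}

/-- `P m = ∑_{j = 0}^m π_m(j) X^j`. -/
noncomputable def P (m : ℕ) : ℂ[X] := ∑ j ∈ Finset.range (m + 1), C (dist m j : ℂ) * X ^ j

/-! ### Greedy expansion along the heights -/

/-- The largest `n` with `h n ≤ k` (for `k ≥ 1`). -/
def topIndex (k : ℕ) : ℕ := Nat.findGreatest (fun n => height n ≤ k) k

/-- What remains of `k` before the `l`-th step of the greedy algorithm: at that step the
largest possible multiple of `h (n - l)` is subtracted, where `n = topIndex k`. -/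
def greedyRem (k : ℕ) : ℕ → ℕ
  | 0 => k
  | l + 1 => greedyRem k l % height (topIndex k - l)

/-- The greedy digits of `k = a 0 * h n + a 1 * h (n - 1) + ⋯ + a n * h 0`, `n = topIndex k`. -/
def greedyDigit (k l : ℕ) : ℕ :=
  if l ≤ topIndex k then greedyRem k l / height (topIndex k - l) else 0

end Chacon

namespace Chacon

/-! ### Chacon's automorphism exists

The definition of `IsChacon` is not vacuous: `isChacon_map0` at the end constructs a realization. -/

/-- The inverse of the adding machine. -/
noncomputable def subtracting (x : Gam) : Gam := fun i => open Classical in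
  if ∀ l < i, x l = 0 then x i - 1 else x i

theorem adding_carry (x : Gam) (i : ℕ) : (∀ l < i, adding x l = 0) ↔ ∀ l < i, x l = 2 := by
  induction i with
  | zero => simp
  | succ i ih =>
    rw [Nat.forall_lt_succ_right, Nat.forall_lt_succ_right, ih]
    refine and_congr_right fun h => ?_
    simp only [adding, if_pos h]
    generalize x i = d
    revert d; decide

theorem subtracting_carry (x : Gam) (i : ℕ) :
    (∀ l < i, subtracting x l = 2) ↔ ∀ l < i, x l = 0 := by
  induction i with
  | zero => simp
  | succ i ih =>
    rw [Nat.forall_lt_succ_right, Nat.forall_lt_succ_right, ih]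
    refine and_congr_right fun h => ?_
    simp only [subtracting, if_pos h]
    generalize x i = d
    revert d; decide

theorem subtracting_adding (x : Gam) : subtracting (adding x) = x := by
  funext i
  by_cases h : ∀ l < i, x l = 2
  · have h' := (adding_carry x i).2 h
    rw [subtracting, if_pos h', adding, if_pos h]; simp
  · have h' := mt (adding_carry x i).1 h
    rw [subtracting, if_neg h', adding, if_neg h]

theorem adding_subtracting (x : Gam) : adding (subtracting x) = x := by
  funext i
  by_cases h : ∀ l < i, x l = 0
  · have h' := (subtracting_carry x i).2 h
    rw [adding, if_pos h', subtracting, if_pos h]; simp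
  · have h' := mt (subtracting_carry x i).1 h
    rw [adding, if_neg h', subtracting, if_neg h]

theorem measurable_adding : Measurable adding := by
  refine measurable_pi_lambda _ fun i => ?_
  unfold adding
  refine Measurable.ite ?_ (by fun_prop) (by fun_prop)
  simp only [Set.ofPred_forall]
  exact .iInter fun l => .iInter fun _ => measurableSet_eq_fun (by fun_prop) (by fun_prop)

theorem measurable_subtracting : Measurable subtracting := by
  refine measurable_pi_lambda _ fun i => ?_
  unfold subtracting
  refine Measurable.ite ?_ (by fun_prop) (by fun_prop)
  simp only [Set.ofPred_forall]
  exact .iInter fun l => .iInter fun _ => measurableSet_eq_fun (by fun_prop) (by fun_prop)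

/-- The set of points whose first `n` digits are those of `a`. -/
def cyl (n : ℕ) (a : Gam) : Set Gam := {x | ∀ l < n, x l = a l}

theorem measurableSet_cyl (n : ℕ) (a : Gam) : MeasurableSet (cyl n a) := by
  simp only [cyl, Set.ofPred_forall]
  exact .iInter fun l => .iInter fun _ => measurableSet_eq_fun (by fun_prop) (by fun_prop)

instance : IsProbabilityMeasure haar := by
  unfold haar
  have : IsProbabilityMeasure (ProbabilityTheory.uniformOn (Set.univ : Set (Fin 3))) :=
    ProbabilityTheory.isProbabilityMeasure_uniformOn Set.finite_univ Set.univ_nonempty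
  infer_instance

theorem haar_cyl (n : ℕ) (a : Gam) : haar (cyl n a) = (1 / 3) ^ n := by
  have : IsProbabilityMeasure (ProbabilityTheory.uniformOn (Set.univ : Set (Fin 3))) :=
    ProbabilityTheory.isProbabilityMeasure_uniformOn Set.finite_univ Set.univ_nonempty
  have h : cyl n a = Set.pi (Finset.range n) fun l => {a l} := by
    ext x; simp [cyl]
  rw [h, haar, Measure.infinitePi_pi]
  · simp [ProbabilityTheory.uniformOn_univ]
  · intro i _; exact measurableSet_singleton _

theorem generateFrom_cyl :
    (MeasurableSpace.pi : MeasurableSpace Gam) =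
      MeasurableSpace.generateFrom (insert ∅ {C | ∃ n a, C = cyl n a}) := by
  apply le_antisymm
  · refine iSup_le fun i => ?_
    rw [← measurable_iff_comap_le]
    refine @measurable_to_countable' _ _ _ _ (_) _ fun d => ?_
    have : (fun x : Gam => x i) ⁻¹' {d} =
        ⋃ a : {a : Fin (i + 1) → Fin 3 // a (Fin.last i) = d},
          cyl (i + 1) fun l => if h : l < i + 1 then a.1 ⟨l, h⟩ else 0 := by
      ext x
      simp only [Set.mem_preimage, Set.mem_singleton_iff, Set.mem_iUnion, cyl, Set.mem_ofPred_eq]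
      constructor
      · intro h
        refine ⟨⟨fun l => x l, by simpa using h⟩, fun l hl => by simp [hl]⟩
      · rintro ⟨⟨a, ha⟩, h⟩
        rw [h i (by omega)]
        simpa [Fin.last] using ha
    rw [this]
    exact MeasurableSet.iUnion fun a => MeasurableSpace.measurableSet_generateFrom
      (Or.inr ⟨_, _, rfl⟩)
  · refine MeasurableSpace.generateFrom_le ?_
    rintro C (rfl | ⟨n, a, rfl⟩)
    · exact .empty
    · exact measurableSet_cyl n a

theorem adding_mem_cyl (x : Gam) (n : ℕ) (a : Gam) :
    adding x ∈ cyl n a ↔ x ∈ cyl n (subtracting a) := by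
  have key : ∀ u v : Gam, (∀ l < n, u l = v l) → ∀ l < n, adding u l = adding v l := by
    intro u v h l hl
    have : (∀ l' < l, u l' = 2) ↔ ∀ l' < l, v l' = 2 :=
      forall₂_congr fun l' hl' => by rw [h l' (by omega)]
    simp only [adding, this, h l hl]
  have key' : ∀ u v : Gam, (∀ l < n, u l = v l) → ∀ l < n, subtracting u l = subtracting v l := by
    intro u v h l hl
    have : (∀ l' < l, u l' = 0) ↔ ∀ l' < l, v l' = 0 :=
      forall₂_congr fun l' hl' => by rw [h l' (by omega)]
    simp only [subtracting, this, h l hl]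
  constructor
  · intro h; have := key' _ _ h; rwa [subtracting_adding] at this
  · intro h; have := key _ _ h; rwa [adding_subtracting] at this

theorem measurePreserving_adding : MeasurePreserving adding haar haar := by
  refine ⟨measurable_adding, ?_⟩
  have : IsProbabilityMeasure (haar.map adding) :=
    Measure.isProbabilityMeasure_map measurable_adding.aemeasurable
  refine ext_of_generate_finite _ generateFrom_cyl ?_ ?_ (by simp)
  · rintro s (rfl | ⟨n, a, rfl⟩) t (rfl | ⟨m, b, rfl⟩) hst
    · simp at hst
    · simp at hst
    · simp at hst
    · right
      obtain ⟨c, hc, hc'⟩ := hst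
      refine ⟨max n m, c, ?_⟩
      ext x
      simp only [cyl, Set.mem_inter_iff, Set.mem_ofPred_eq] at *
      constructor
      · rintro ⟨h1, h2⟩ l hl
        rcases lt_max_iff.1 hl with hl | hl
        · rw [h1 l hl, hc l hl]
        · rw [h2 l hl, hc' l hl]
      · intro h
        exact ⟨fun l hl => by rw [h l (by omega), hc l hl],
          fun l hl => by rw [h l (by omega), hc' l hl]⟩
  · rintro s (rfl | ⟨n, a, rfl⟩)
    · simp
    · rw [Measure.map_apply measurable_adding (measurableSet_cyl n a)]
      have : adding ⁻¹' cyl n a = cyl n (subtracting a) := by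
        ext x; exact adding_mem_cyl x n a
      rw [this, haar_cyl, haar_cyl]

/-- The sequence `a 0, …, a (n - 1), y 0, y 1, …`. -/
def app (n : ℕ) (a y : Gam) : Gam := fun i => if i < n then a i else y (i - n)

/-- The sequence `d, y 0, y 1, …`. -/
def cons (d : Fin 3) (y : Gam) : Gam := fun i => if i = 0 then d else y (i - 1)

theorem app_cons (n : ℕ) (a y : Gam) (d : Fin 3) :
    app n a (cons d y) = app (n + 1) (fun i => if i < n then a i else d) y := by
  funext i
  simp only [app, cons]
  rcases lt_trichotomy i n with h | h | h
  · simp [h, Nat.lt_succ_of_lt h]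
  · simp [h]
  · rw [if_neg (by omega), if_neg (by omega), if_neg (by omega)]
    congr 1

theorem app_zero_cons (n : ℕ) (y : Gam) : app n 0 (cons 0 y) = app (n + 1) 0 y := by
  rw [app_cons]; congr 1; funext i; simp

theorem phi_eq_one (x : Gam) : phi x = 1 ↔ ∃ n, (∀ l < n, x l = 2) ∧ x n = 1 := by
  unfold phi
  split_ifs with h
  · have h1 := Nat.find_spec h
    have h2 : ∀ l < Nat.find h, x l = 2 := fun l hl => not_not.1 (Nat.find_min h hl)
    constructor
    · intro h3; exact ⟨_, h2, by ext; simpa using h3⟩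
    · rintro ⟨n, hn, hn'⟩
      have : Nat.find h = n := by
        rw [Nat.find_eq_iff]
        exact ⟨by rw [hn']; decide, fun l hl => by simpa using hn l hl⟩
      rw [this, hn']; rfl
  · push Not at h
    simp [h]

theorem phi_le_one (x : Gam) : phi x = 0 ∨ phi x = 1 := by
  unfold phi
  split_ifs with h
  · have h1 := Nat.find_spec h
    revert h1
    generalize x _ = d
    revert d; decide
  · exact Or.inl rfl

theorem phi_cons_zero (y : Gam) : phi (cons 0 y) = 0 := by
  rcases phi_le_one (cons 0 y) with h | h
  · exact h
  · obtain ⟨n, h1, h2⟩ := (phi_eq_one _).1 h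
    cases n with
    | zero => simp [cons] at h2
    | succ n => have := h1 0 (by omega); simp [cons] at this

theorem phi_cons_one (y : Gam) : phi (cons 1 y) = 1 :=
  (phi_eq_one _).2 ⟨0, by simp, by simp [cons]⟩

theorem phi_cons_two (y : Gam) : phi (cons 2 y) = phi y := by
  have : phi (cons 2 y) = 1 ↔ phi y = 1 := by
    rw [phi_eq_one, phi_eq_one]
    constructor
    · rintro ⟨n, h1, h2⟩
      cases n with
      | zero => simp [cons] at h2
      | succ n =>
        refine ⟨n, fun l hl => by simpa [cons] using h1 (l + 1) (by omega), by
          simpa [cons] using h2⟩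
    · rintro ⟨n, h1, h2⟩
      refine ⟨n + 1, fun l hl => ?_, by simpa [cons] using h2⟩
      cases l with
      | zero => simp [cons]
      | succ l => simpa [cons] using h1 l (by omega)
  rcases phi_le_one (cons 2 y) with h | h <;> rcases phi_le_one y with h' | h' <;> omega

theorem adding_cons (d : Fin 3) (hd : d ≠ 2) (y : Gam) :
    adding (cons d y) = cons (d + 1) y := by
  funext i
  cases i with
  | zero => simp [adding, cons]
  | succ i =>
    have : ¬ ∀ l < i + 1, cons d y l = 2 := fun h => hd (h 0 (by omega))
    rw [adding, if_neg this]
    simp [cons]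

theorem adding_cons_two (y : Gam) : adding (cons 2 y) = cons 0 (adding y) := by
  funext i
  cases i with
  | zero => simp [adding, cons]
  | succ i =>
    have : (∀ l < i + 1, cons 2 y l = 2) ↔ ∀ l < i, y l = 2 := by
      constructor
      · intro h l hl; simpa [cons] using h (l + 1) (by omega)
      · intro h l hl
        cases l with
        | zero => simp [cons]
        | succ l => simpa [cons] using h l (by omega)
    rw [adding]
    simp only [this]
    simp [cons, adding]

/-- The integral automorphism over the adding machine with return time `1 + φ`, extended by the
identity outside of its domain `{(x, i) | i ≤ φ x}`. -/
noncomputable def map0 (p : Gam × Bool) : Gam × Bool :=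
  if p.2 = false then (if phi p.1 = 1 then (p.1, true) else (adding p.1, false))
  else (if phi p.1 = 1 then (adding p.1, false) else (p.1, true))

/-- The inverse of `map0`. -/
noncomputable def map0Inv (p : Gam × Bool) : Gam × Bool :=
  if p.2 = false then
    (if phi (subtracting p.1) = 1 then (subtracting p.1, true) else (subtracting p.1, false))
  else (if phi p.1 = 1 then (p.1, false) else (p.1, true))

theorem measurableSet_phi : MeasurableSet {x | phi x = 1} := by
  have : {x | phi x = 1} = ⋃ n, (cyl n fun _ => 2) ∩ (fun x : Gam => x n) ⁻¹' {1} := by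
    ext x; simp [phi_eq_one, cyl]
  rw [this]
  exact .iUnion fun n => (measurableSet_cyl _ _).inter (measurable_pi_apply n (.singleton _))

theorem measurable_map0 : Measurable map0 := by
  have h1 : MeasurableSet {p : Gam × Bool | p.2 = false} :=
    measurable_snd (measurableSet_singleton false)
  have h2 : MeasurableSet {p : Gam × Bool | phi p.1 = 1} := measurable_fst measurableSet_phi
  have := measurable_adding
  unfold map0
  exact .ite h1 (.ite h2 (by fun_prop) (by fun_prop)) (.ite h2 (by fun_prop) (by fun_prop))

theorem measurable_map0Inv : Measurable map0Inv := by
  have := measurable_subtracting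
  have h1 : MeasurableSet {p : Gam × Bool | p.2 = false} :=
    measurable_snd (measurableSet_singleton false)
  have h2 : MeasurableSet {p : Gam × Bool | phi p.1 = 1} := measurable_fst measurableSet_phi
  have h3 : MeasurableSet {p : Gam × Bool | phi (subtracting p.1) = 1} :=
    (measurable_subtracting.comp measurable_fst) measurableSet_phi
  unfold map0Inv
  exact .ite h1 (.ite h3 (by fun_prop) (by fun_prop)) (.ite h2 (by fun_prop) (by fun_prop))

/-- `map0` as an automorphism. -/
noncomputable def map0Equiv : Gam × Bool ≃ᵐ Gam × Bool where
  toFun := map0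
  invFun := map0Inv
  left_inv := by
    rintro ⟨x, b⟩
    cases b <;> by_cases h : phi x = 1 <;> simp [map0, map0Inv, h, subtracting_adding]
  right_inv := by
    rintro ⟨x, b⟩
    cases b
    · by_cases h : phi (subtracting x) = 1 <;> simp [map0, map0Inv, h, adding_subtracting]
    · by_cases h : phi x = 1 <;> simp [map0, map0Inv, h]
  measurable_toFun := measurable_map0
  measurable_invFun := measurable_map0Inv

/-- Two copies of Haar measure. -/
noncomputable def twoHaar : Measure (Gam × Bool) :=
  haar.map (fun x => (x, false)) + haar.map (fun x => (x, true))

instance : IsFiniteMeasure twoHaar := by unfold twoHaar; infer_instance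

theorem twoHaar_apply {A : Set (Gam × Bool)} (hA : MeasurableSet A) :
    twoHaar A = haar {x | (x, false) ∈ A} + haar {x | (x, true) ∈ A} := by
  rw [twoHaar, Measure.add_apply, Measure.map_apply (by fun_prop) hA,
    Measure.map_apply (by fun_prop) hA]
  rfl

theorem measurePreserving_map0 : MeasurePreserving map0 twoHaar twoHaar := by
  refine ⟨measurable_map0, ?_⟩
  ext A hA
  rw [Measure.map_apply measurable_map0 hA, twoHaar_apply hA, twoHaar_apply (measurable_map0 hA)]
  have hf : MeasurableSet {x : Gam | (x, false) ∈ A} :=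
    (show Measurable fun x : Gam => (x, false) by fun_prop) hA
  have ht : MeasurableSet {x : Gam | (x, true) ∈ A} :=
    (show Measurable fun x : Gam => (x, true) by fun_prop) hA
  have e1 : {x | (x, false) ∈ map0 ⁻¹' A} =
      ({x | (x, true) ∈ A} ∩ {x | phi x = 1}) ∪ (adding ⁻¹' {x | (x, false) ∈ A} \ {x | phi x = 1}) := by
    ext x; by_cases h : phi x = 1 <;> simp [map0, h]
  have e2 : {x | (x, true) ∈ map0 ⁻¹' A} =
      (adding ⁻¹' {x | (x, false) ∈ A} ∩ {x | phi x = 1}) ∪ ({x | (x, true) ∈ A} \ {x | phi x = 1}) := by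
    ext x; by_cases h : phi x = 1 <;> simp [map0, h]
  rw [e1, e2, measure_union (Set.disjoint_sdiff_right.mono_left Set.inter_subset_right)
      ((measurable_adding hf).diff measurableSet_phi),
    measure_union (Set.disjoint_sdiff_right.mono_left Set.inter_subset_right)
      (ht.diff measurableSet_phi)]
  rw [← measurePreserving_adding.measure_preimage hf.nullMeasurableSet,
    ← measure_inter_add_sdiff (adding ⁻¹' {x | (x, false) ∈ A}) measurableSet_phi,
    ← measure_inter_add_sdiff {x | (x, true) ∈ A} measurableSet_phi]
  ring

/-- The domain `{(x, i) | i ≤ φ x}`. -/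
def dom : Set (Gam × Bool) := {p | p.2 = true → phi p.1 = 1}

theorem measurableSet_dom : MeasurableSet dom := by
  have : dom = {p : Gam × Bool | p.2 = true}ᶜ ∪ {p | phi p.1 = 1} := by
    ext p; simp [dom, imp_iff_not_or]
  rw [this]
  exact (measurable_snd (measurableSet_singleton true)).compl.union
    (measurable_fst measurableSet_phi)

/-- The normalized measure on the domain. -/
noncomputable def mu0 : Measure (Gam × Bool) := ProbabilityTheory.cond twoHaar dom

theorem twoHaar_dom : 1 ≤ twoHaar dom := by
  rw [twoHaar_apply measurableSet_dom]
  have : {x : Gam | (x, false) ∈ dom} = Set.univ := by ext; simp [dom]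
  rw [this, measure_univ]
  exact le_self_add

instance : IsProbabilityMeasure mu0 :=
  ProbabilityTheory.cond_isProbabilityMeasure (one_pos.trans_le twoHaar_dom).ne'

theorem mu0_le {A : Set (Gam × Bool)} : mu0 A ≤ twoHaar (A ∩ dom) := by
  rw [mu0, ProbabilityTheory.cond_apply measurableSet_dom, Set.inter_comm]
  exact mul_le_of_le_one_left (by simp) (by simpa using twoHaar_dom)

theorem measurePreserving_mu0 : MeasurePreserving map0Equiv mu0 mu0 := by
  have h : map0 ⁻¹' dom = dom := by
    ext ⟨x, b⟩
    cases b <;> by_cases h : phi x = 1 <;> simp [map0, dom, h]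
  have := (measurePreserving_map0.restrict_preimage measurableSet_dom).smul_measure
    (twoHaar dom)⁻¹
  rw [h] at this
  exact this

/-- The bases of the towers. -/
def base (n : ℕ) : Set (Gam × Bool) := Set.range fun y => (app n 0 y, false)

theorem map0_return (n : ℕ) : ∀ y : Gam,
    map0^[height n + phi y] (app n 0 y, false) = (app n 0 (adding y), false) := by
  induction n with
  | zero =>
    intro y
    have e : ∀ z : Gam, app 0 0 z = z := fun z => by funext i; simp [app]
    rcases phi_le_one y with h | h <;> simp [e, height, h, map0]
  | succ n ih =>
    intro y
    have h0 := ih (cons 0 y)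
    have h1 := ih (cons 1 y)
    have h2 := ih (cons 2 y)
    rw [phi_cons_zero, adding_cons _ (by decide)] at h0
    rw [phi_cons_one, adding_cons _ (by decide)] at h1
    rw [phi_cons_two, adding_cons_two] at h2
    have : height (n + 1) + phi y = (height n + phi y) + ((height n + 1) + (height n + 0)) := by
      simp only [height]; ring
    rw [this, Function.iterate_add_apply (m := height n + phi y), Function.iterate_add_apply
      (m := height n + 1), ← app_zero_cons, h0]
    rw [show (0 : Fin 3) + 1 = 1 from rfl, h1, show (1 : Fin 3) + 1 = 2 from rfl, h2,
      app_zero_cons]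

theorem map0_one (n : ℕ) (y : Gam) :
    map0^[height n] (app (n + 1) 0 y, false) = (app n 0 (cons 1 y), false) := by
  have h0 := map0_return n (cons 0 y)
  rw [phi_cons_zero, adding_cons _ (by decide), app_zero_cons] at h0
  simpa using h0

theorem map0_two (n : ℕ) (y : Gam) :
    map0^[2 * height n + 1] (app (n + 1) 0 y, false) = (app n 0 (cons 2 y), false) := by
  have h1 := map0_return n (cons 1 y)
  rw [phi_cons_one, adding_cons _ (by decide)] at h1
  rw [show 2 * height n + 1 = (height n + 1) + height n by ring, Function.iterate_add_apply,
    map0_one, h1]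
  rfl

theorem cons_surj (y : Gam) : ∃ d z, y = cons d z :=
  ⟨y 0, fun i => y (i + 1), by funext i; cases i <;> simp [cons]⟩

theorem app_cons_mem (n : ℕ) (d : Fin 3) (y : Gam) :
    (app n 0 (cons d y), false) ∈ base (n + 1) ↔ d = 0 := by
  constructor
  · rintro ⟨z, hz⟩
    have := congrFun (congrArg Prod.fst hz) n
    simpa [app, cons] using this.symm
  · rintro rfl
    exact ⟨y, by simp [app_zero_cons]⟩

theorem base_eq (n : ℕ) : base n = base (n + 1) ∪ map0^[height n] '' base (n + 1) ∪
    map0^[2 * height n + 1] '' base (n + 1) := by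
  ext p
  constructor
  · rintro ⟨y, rfl⟩
    obtain ⟨d, z, rfl⟩ := cons_surj y
    have : d = 0 ∨ d = 1 ∨ d = 2 := by revert d; decide
    rcases this with rfl | rfl | rfl
    · exact Or.inl (Or.inl ((app_cons_mem _ _ _).2 rfl))
    · exact Or.inl (Or.inr ⟨_, ⟨z, rfl⟩, map0_one n z⟩)
    · exact Or.inr ⟨_, ⟨z, rfl⟩, map0_two n z⟩
  · rintro ((⟨y, rfl⟩ | ⟨_, ⟨y, rfl⟩, rfl⟩) | ⟨_, ⟨y, rfl⟩, rfl⟩)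
    · exact ⟨cons 0 y, by simp [app_zero_cons]⟩
    · exact ⟨cons 1 y, (map0_one n y).symm⟩
    · exact ⟨cons 2 y, (map0_two n y).symm⟩

theorem map0_no_return (n : ℕ) : ∀ y : Gam, ∀ d, 0 < d → d < height n + phi y →
    map0^[d] (app n 0 y, false) ∉ base n := by
  induction n with
  | zero =>
    rintro y d hd hd' ⟨z, hz⟩
    have h1 : phi y = 1 := by
      rcases phi_le_one y with h | h <;> simp [height, h] at hd' ⊢; omega
    have : d = 1 := by simp [height, h1] at hd'; omega
    subst this
    have e : ∀ z : Gam, app 0 0 z = z := fun z => by funext i; simp [app]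
    simp [e, map0, h1] at hz
  | succ n ih =>
    intro y d hd hd' hmem
    have hsub : base (n + 1) ⊆ base n := by
      rw [base_eq n]; exact Set.subset_union_left.trans Set.subset_union_left
    rw [show height (n + 1) = 3 * height n + 1 from rfl] at hd'
    rcases lt_trichotomy d (height n) with h | h | h
    · refine ih (cons 0 y) d hd (by omega) ?_
      rw [app_zero_cons]; exact hsub hmem
    · rw [h, map0_one, app_cons_mem] at hmem
      exact absurd hmem (by decide)
    rcases lt_trichotomy d (2 * height n + 1) with h' | h' | h'
    · refine ih (cons 1 y) (d - height n) (by omega) (by rw [phi_cons_one]; omega) ?_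
      rw [← map0_one, ← Function.iterate_add_apply, Nat.sub_add_cancel h.le]
      exact hsub hmem
    · rw [h', map0_two, app_cons_mem] at hmem
      exact absurd hmem (by decide)
    · refine ih (cons 2 y) (d - (2 * height n + 1)) (by omega) (by rw [phi_cons_two]; omega) ?_
      rw [← map0_two, ← Function.iterate_add_apply, Nat.sub_add_cancel h'.le]
      exact hsub hmem

theorem map0_injective : Function.Injective map0 := map0Equiv.injective

theorem levels_disjoint (n i j : ℕ) (hj : j < height n) (hij : i < j) :
    Disjoint (map0^[i] '' base n) (map0^[j] '' base n) := by
  rw [Set.disjoint_left]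
  rintro _ ⟨p, hp, rfl⟩ ⟨_, ⟨y, rfl⟩, h⟩
  rw [← Nat.add_sub_cancel' hij.le, Function.iterate_add_apply] at h
  have := map0_injective.iterate i h
  refine map0_no_return n y (j - i) (by omega) (by omega) ?_
  rw [this]; exact hp

theorem map0_spacer (n : ℕ) (y : Gam) : map0^[2 * height n] (app (n + 1) 0 y, false) =
    (app n (fun _ => 2) (cons 1 y), true) := by
  apply map0_injective
  have h1 : phi (app n (fun _ => 2) (cons 1 y)) = 1 :=
    (phi_eq_one _).2 ⟨n, fun l hl => by simp [app, hl], by simp [app, cons]⟩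
  have h2 : adding (app n (fun _ => 2) (cons 1 y)) = app n 0 (cons 2 y) := by
    funext i
    rcases lt_trichotomy i n with h | h | h
    · have : ∀ l < i, app n (fun _ => 2) (cons 1 y) l = 2 := fun l hl => by
        simp [app, hl.trans h]
      simp only [adding, if_pos this]
      simp [app, h]
    · have : ∀ l < i, app n (fun _ => 2) (cons 1 y) l = 2 := fun l hl => by
        simp [app, h ▸ hl]
      simp only [adding, if_pos this]
      simp [app, h, cons]
    · have : ¬ ∀ l < i, app n (fun _ => 2) (cons 1 y) l = 2 := fun hh => by
        have := hh n h; simp [app, cons] at this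
      simp only [adding, if_neg this]
      have h3 : ¬ i < n := by omega
      have h4 : i - n ≠ 0 := by omega
      simp [app, cons, h3, h4]
  rw [← Function.iterate_succ_apply' map0, map0_two]
  simp [map0, h1, h2]

theorem level_form (n : ℕ) : ∀ i < height n, ∃ a b, ∀ y : Gam,
    map0^[i] (app n 0 y, false) = (app n a y, b) := by
  induction n with
  | zero =>
    intro i hi
    have : i = 0 := by simp [height] at hi; omega
    subst this
    exact ⟨0, false, fun y => rfl⟩
  | succ n ih =>
    intro i hi
    rw [show height (n + 1) = 3 * height n + 1 from rfl] at hi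
    rcases lt_or_ge i (height n) with h | h
    · obtain ⟨a, b, hab⟩ := ih i h
      exact ⟨fun l => if l < n then a l else 0, b, fun y => by
        rw [← app_zero_cons, hab, app_cons]⟩
    rcases lt_trichotomy i (2 * height n) with h' | h' | h'
    · obtain ⟨a, b, hab⟩ := ih (i - height n) (by omega)
      refine ⟨fun l => if l < n then a l else 1, b, fun y => ?_⟩
      rw [← Nat.sub_add_cancel h, Function.iterate_add_apply, map0_one]
      rw [hab, app_cons]
    · exact ⟨_, true, fun y => by rw [h', map0_spacer, app_cons]⟩
    · obtain ⟨a, b, hab⟩ := ih (i - (2 * height n + 1)) (by omega)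
      refine ⟨fun l => if l < n then a l else 2, b, fun y => ?_⟩
      rw [← Nat.sub_add_cancel (show 2 * height n + 1 ≤ i from h'), Function.iterate_add_apply,
        map0_two]
      rw [hab, app_cons]

theorem level_cover (n : ℕ) (p : Gam × Bool) (hp : p ∈ dom)
    (hp' : p.2 = true → p.1 ∉ cyl n fun _ => 2) : ∃ i < height n, p ∈ map0^[i] '' base n := by
  induction n with
  | zero =>
    obtain ⟨x, b⟩ := p
    cases b
    · exact ⟨0, by simp [height], (x, false), ⟨x, by congr 1⟩, rfl⟩
    · exact absurd (fun l _ => by omega) (hp' rfl)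
  | succ n ih =>
    by_cases h : p.2 = true → p.1 ∉ cyl n fun _ => 2
    · obtain ⟨i, hi, q, hq, rfl⟩ := ih h
      rw [base_eq] at hq
      have hh : height (n + 1) = 3 * height n + 1 := rfl
      rcases hq with (hq | ⟨r, hr, rfl⟩) | ⟨r, hr, rfl⟩
      · exact ⟨i, by omega, q, hq, rfl⟩
      · exact ⟨i + height n, by omega, r, hr, Function.iterate_add_apply ..⟩
      · exact ⟨i + (2 * height n + 1), by omega, r, hr, Function.iterate_add_apply ..⟩
    · push Not at h
      obtain ⟨hb, hx⟩ := h
      obtain ⟨x, b⟩ := p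
      simp only at hb hx
      subst hb
      have hx1 := (phi_eq_one x).1 (hp rfl)
      obtain ⟨m, hm, hm'⟩ := hx1
      have hx2 : x n ≠ 2 := fun h2 => hp' rfl fun l hl => by
        rcases Nat.lt_succ_iff_lt_or_eq.1 hl with h3 | rfl
        · exact hx l h3
        · exact h2
      have hmn : m = n := by
        rcases lt_trichotomy m n with h3 | h3 | h3
        · have := hx m h3; simp [hm'] at this
        · exact h3
        · exact absurd (hm n h3) hx2
      subst hmn
      have hh : height (m + 1) = 3 * height m + 1 := rfl
      refine ⟨2 * height m, by omega, _, ⟨fun i => x (i + m + 1), rfl⟩, ?_⟩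
      simp only
      rw [map0_spacer]
      congr 1
      funext i
      simp only [app, cons]
      split_ifs with h1 h2
      · exact (hx i h1).symm
      · rw [← hm']; congr 1; omega
      · congr 1; omega

/-- The sets that depend on finitely many digits. -/
def finDet : Set (Set (Gam × Bool)) :=
  {C | ∃ n, ∀ x y : Gam, ∀ b, (∀ l < n, x l = y l) → ((x, b) ∈ C ↔ (y, b) ∈ C)}

theorem isSetAlgebra_finDet : IsSetAlgebra finDet where
  empty_mem := ⟨0, by simp⟩
  compl_mem := by
    rintro C ⟨n, h⟩
    exact ⟨n, fun x y b hxy => not_congr (h x y b hxy)⟩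
  union_mem := by
    rintro C D ⟨n, h⟩ ⟨m, h'⟩
    exact ⟨max n m, fun x y b hxy => or_congr (h x y b fun l hl => hxy l (by omega))
      (h' x y b fun l hl => hxy l (by omega))⟩

theorem measurableSet_of_finDet {C : Set (Gam × Bool)} (hC : C ∈ finDet) : MeasurableSet C := by
  obtain ⟨n, h⟩ := hC
  have : C = (fun p : Gam × Bool => ((fun l : Fin n => p.1 l), p.2)) ⁻¹'
      ((fun p : Gam × Bool => ((fun l : Fin n => p.1 l), p.2)) '' C) := by
    refine (Set.subset_preimage_image _ _).antisymm ?_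
    rintro ⟨x, b⟩ ⟨⟨y, b'⟩, hy, hxy⟩
    simp only [Prod.mk.injEq] at hxy
    obtain ⟨h1, rfl⟩ := hxy
    exact (h y x b' fun l hl => congrFun h1 ⟨l, hl⟩).1 hy
  rw [this]
  exact (show Measurable (fun p : Gam × Bool => ((fun l : Fin n => p.1 l), p.2)) by fun_prop)
    (Set.toFinite _).measurableSet

theorem generateFrom_finDet : (Prod.instMeasurableSpace : MeasurableSpace (Gam × Bool)) =
    MeasurableSpace.generateFrom finDet := by
  apply le_antisymm
  · refine sup_le ?_ ?_
    · rw [← measurable_iff_comap_le]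
      refine @measurable_pi_lambda _ _ _ (_) _ _ fun i => ?_
      refine @measurable_to_countable' _ _ _ _ (_) _ fun d => ?_
      refine MeasurableSpace.measurableSet_generateFrom ⟨i + 1, fun x y b hxy => ?_⟩
      simp [hxy i]
    · rw [← measurable_iff_comap_le]
      refine @measurable_to_countable' _ _ _ _ (_) _ fun d => ?_
      exact MeasurableSpace.measurableSet_generateFrom ⟨0, fun x y b hxy => by simp⟩
  · exact MeasurableSpace.generateFrom_le fun C => measurableSet_of_finDet

theorem levels_exhaust (A : Set (Gam × Bool)) (hA : MeasurableSet A) (ε : ENNReal) (hε : 0 < ε) :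
    ∃ n, ∃ s ⊆ Finset.range (height n), mu0 (symmDiff A (⋃ i ∈ s, map0^[i] '' base n)) < ε := by
  wlog hε1 : ε ≤ 1 generalizing ε
  · obtain ⟨n, s, hs, h⟩ := this 1 one_pos le_rfl
    exact ⟨n, s, hs, h.trans (not_le.1 hε1)⟩
  have hε2 : ε ≠ ⊤ := (hε1.trans_lt ENNReal.one_lt_top).ne
  obtain ⟨C, hC, hAC⟩ := (Measure.MeasureDense.of_generateFrom_isSetAlgebra_finite (μ := mu0)
    isSetAlgebra_finDet generateFrom_finDet).approx A hA (measure_ne_top _ _)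
    (ε.toReal / 2) (half_pos (ENNReal.toReal_pos hε.ne' hε2))
  obtain ⟨n₀, hn₀⟩ := hC
  obtain ⟨n₁, hn₁⟩ := ((ENNReal.tendsto_pow_atTop_nhds_zero_of_lt_one (r := 1 / 3) (by
    rw [one_div]; exact ENNReal.inv_lt_one.2 (by norm_num))).eventually_lt_const
    (ENNReal.half_pos hε.ne')).exists
  set n := max n₀ n₁ with hn
  have hC' : ∀ x y : Gam, ∀ b, (∀ l < n, x l = y l) → ((x, b) ∈ C ↔ (y, b) ∈ C) :=
    fun x y b hxy => hn₀ x y b fun l hl => hxy l (by omega)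
  classical
  refine ⟨n, {i ∈ Finset.range (height n) | map0^[i] '' base n ⊆ C}, Finset.filter_subset _ _, ?_⟩
  set B := ⋃ i ∈ ({i ∈ Finset.range (height n) | map0^[i] '' base n ⊆ C} : Finset ℕ),
    map0^[i] '' base n with hB
  have hBC : B ⊆ C := by
    simp only [hB, Finset.mem_filter]
    exact Set.iUnion₂_subset fun i hi => hi.2
  have hCB : (C \ B) ∩ dom ⊆ {p | p.2 = true ∧ p.1 ∈ cyl n fun _ => 2} := by
    rintro p ⟨⟨hpC, hpB⟩, hpd⟩
    by_contra hp
    obtain ⟨i, hi, hpi⟩ := level_cover n p hpd fun h1 h2 => hp ⟨h1, h2⟩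
    refine hpB ?_
    simp only [hB, Set.mem_iUnion]
    refine ⟨i, Finset.mem_filter.2 ⟨Finset.mem_range.2 hi, ?_⟩, hpi⟩
    obtain ⟨a, b, hab⟩ := level_form n i hi
    obtain ⟨_, ⟨y, rfl⟩, rfl⟩ := hpi
    rintro _ ⟨_, ⟨z, rfl⟩, rfl⟩
    simp only [hab] at hpC ⊢
    exact (hC' _ _ _ fun l hl => by simp [app, hl]).1 hpC
  have hAB : symmDiff A B ⊆ symmDiff A C ∪ (C \ B) := by
    intro p
    have := @hBC p
    simp only [Set.mem_union, Set.mem_symmDiff, Set.mem_sdiff]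
    tauto
  have hsmall : mu0 (C \ B) ≤ (1 / 3) ^ n := by
    have hmeas : MeasurableSet {p : Gam × Bool | p.2 = true ∧ p.1 ∈ cyl n fun _ => 2} :=
      (measurable_snd (measurableSet_singleton true)).inter
        (measurable_fst (measurableSet_cyl _ _))
    calc mu0 (C \ B) ≤ twoHaar ((C \ B) ∩ dom) := mu0_le
      _ ≤ twoHaar {p | p.2 = true ∧ p.1 ∈ cyl n fun _ => 2} := measure_mono hCB
      _ = (1 / 3) ^ n := by
        rw [twoHaar_apply hmeas]
        rw [← haar_cyl n fun _ => 2]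
        simp
  calc mu0 (symmDiff A B) ≤ mu0 (symmDiff A C) + mu0 (C \ B) :=
        (measure_mono hAB).trans (measure_union_le _ _)
    _ < ε / 2 + ε / 2 := by
      refine ENNReal.add_lt_add ?_ ?_
      · rwa [ENNReal.ofReal_div_of_pos two_pos, ENNReal.ofReal_toReal hε2,
          ENNReal.ofReal_ofNat] at hAC
      · exact hsmall.trans_lt ((pow_le_pow_right_of_le_one' (by
          rw [one_div]; exact ENNReal.inv_le_one.2 (by norm_num))
          (le_max_right n₀ n₁)).trans_lt hn₁)
    _ = ε := ENNReal.add_halves ε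

/-- Chacon's automorphism exists: the integral automorphism over the adding machine with return
time `1 + φ` is a realization of it. -/
theorem isChacon_map0 : IsChacon map0Equiv mu0 where
  measurePreserving := measurePreserving_mu0
  exists_towers := by
    refine ⟨base, fun n => ?_, fun n i hi j hj hij => ?_, base_eq, levels_exhaust⟩
    · refine measurableSet_of_finDet ⟨n, fun x y b hxy => ?_⟩
      have : ∀ x : Gam, (x, b) ∈ base n ↔ (∀ l < n, x l = 0) ∧ b = false := by
        intro x
        constructor
        · rintro ⟨z, hz⟩
          simp only [Prod.mk.injEq] at hz
          refine ⟨fun l hl => ?_, hz.2.symm⟩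
          rw [← hz.1]; simp [app, hl]
        · rintro ⟨h, rfl⟩
          refine ⟨fun i => x (i + n), ?_⟩
          simp only [Prod.mk.injEq, and_true]
          funext i
          simp only [app]
          split_ifs with hi
          · simp [h i hi]
          · congr 1; omega
      rw [this, this]
      refine and_congr_left fun _ => forall₂_congr fun l hl => by rw [hxy l hl]
    · rcases lt_or_gt_of_ne hij with h | h
      · exact levels_disjoint n i j hj h
      · exact (levels_disjoint n j i hi h).symm

end Chacon

/-!
Let `E n` be the base of Tower `n`. The three sub-columns into which each tower is cut give the points
of `E n` coordinates in `Γ` (`coords`), which are uniformly distributed (`map_coords`), and the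
first return to `E n` takes the time `height n + φ` and acts on the coordinates as the adding machine
(`first_return`). Hence after the time `m * height n` a point of a level of Tower `n` is found `φ^(m)`
levels below, and this delay is independent of the level. On the levels that stay away from the ends
of the tower, `T̂ ^ (-(q + m * height n))` therefore agrees, tested against functions that are constant
on levels, with `P m T̂ * T̂ ^ (-q)` (`inner_koopmanPow_vec`).

The greedy digits give `k = m_r * h_(n - r) + q` with `m_(r + 1) = 3 * m_r + a_(r + 1)` and `q` between
`0` and `h_(n - r)`, up to a constant (`eq_lead_mul_add`).

If the digits are eventually all `0` (all `2`), then `k` differs from `m_r * h_(n - r)` (from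
`(m_r + 1) * h_(n - r)`) by a number that is negligible with respect to the height
(`tendsto_sub_div_height`). Only the levels near the ends of the tower are then not covered by the
identity above, and they have small measure. A subsequence along which the remaining powers converge
gives `L'`; it exists by sequential compactness of the unit ball (`exists_subseq_weak_tendsto`).

Otherwise the levels split, for each `r`, into those that `T ^ q` keeps in the tower, where `P m_r`
acts, and those that it takes through the top, where `P (m_r + 1)` acts. This bounds `⟪g, L f⟫` by
`‖(P m_r T̂)† g‖ + ‖(P (m_r + 1) T̂)† g‖` (`norm_inner_limit_le`). On the unit circle, the recursion
of `P (3 m)`, `P (3 m + 1)`, `P (3 m + 2)` in terms of `P m` and `P (m + 1)` contracts by the factor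
`(1 + |1 + z|) / 3 < 1`, `z ≠ 1`, each time that both a digit different from `0` and a digit different
from `2` have occurred (`norm_eval_P_lead_le`). So `(1 - z) P m_r z` tends to `0` uniformly, which
with ergodicity (`eq_zero_of_invariant`) shows that the bound tends to `0` when `g` has integral `0`.
Thus `L` takes its values in the constants, and it preserves integrals.
-/

namespace Chacon

/-! ### The polynomials `P m` -/

/-- A finite measure on `Γ` is determined by the measures of the cylinders. -/
theorem measure_ext_cyl {ν ρ : Measure Gam} [IsFiniteMeasure ν]
    (h : ∀ n a, ν (cyl n a) = ρ (cyl n a)) : ν = ρ := by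
  have huniv : cyl 0 0 = (Set.univ : Set Gam) := by ext; simp [cyl]
  refine ext_of_generate_finite _ generateFrom_cyl ?_ ?_ (by rw [← huniv]; exact h 0 0)
  · rintro s (rfl | ⟨n, a, rfl⟩) t (rfl | ⟨m, b, rfl⟩) hst
    · simp at hst
    · simp at hst
    · simp at hst
    · right
      obtain ⟨c, hc, hc'⟩ := hst
      refine ⟨max n m, c, ?_⟩
      ext x
      simp only [cyl, Set.mem_inter_iff, Set.mem_ofPred_eq] at *
      constructor
      · rintro ⟨h1, h2⟩ l hl
        rcases lt_max_iff.1 hl with hl | hl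
        · rw [h1 l hl, hc l hl]
        · rw [h2 l hl, hc' l hl]
      · intro h
        exact ⟨fun l hl => by rw [h l (by omega), hc l hl],
          fun l hl => by rw [h l (by omega), hc' l hl]⟩
  · rintro s (rfl | ⟨n, a, rfl⟩)
    · simp
    · exact h n a

/-- The sequence without its first digit. -/
def tail (x : Gam) : Gam := fun i => x (i + 1)

theorem cons_mem_cyl_succ (d : Fin 3) (y : Gam) (n : ℕ) (a : Gam) :
    cons d y ∈ cyl (n + 1) a ↔ d = a 0 ∧ y ∈ cyl n (tail a) := by
  simp only [cyl, Set.mem_ofPred_eq, cons, tail]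
  constructor
  · intro h
    exact ⟨by simpa using h 0 (by omega), fun l hl => by simpa using h (l + 1) (by omega)⟩
  · rintro ⟨h1, h2⟩ l hl
    cases l with
    | zero => simpa using h1
    | succ l => simpa using h2 l (by omega)

theorem measurable_cons (d : Fin 3) : Measurable (cons d) := by
  refine measurable_pi_lambda _ fun i => ?_
  unfold cons
  split_ifs <;> fun_prop

/-- The first digit is uniform and independent of the other ones. -/
theorem haar_eq_sum_cons :
    haar = ∑ d : Fin 3, ((1 / 3 : NNReal) : ENNReal) • haar.map (cons d) := by
  refine measure_ext_cyl fun n a => ?_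
  have hmap : ∀ d, haar.map (cons d) (cyl n a) = haar (cons d ⁻¹' cyl n a) := fun d =>
    Measure.map_apply (measurable_cons d) (measurableSet_cyl n a)
  have h3 : ((1 / 3 : NNReal) : ENNReal) = 1 / 3 := by
    rw [ENNReal.coe_div (by norm_num)]; simp
  simp only [Measure.finsetSum_apply, Measure.smul_apply, hmap, smul_eq_mul, h3]
  cases n with
  | zero =>
    have huniv : cyl 0 a = (Set.univ : Set Gam) := by ext; simp [cyl]
    simp only [huniv, Set.preimage_univ, measure_univ, Finset.sum_const, Finset.card_univ,
      Fintype.card_fin, nsmul_eq_mul]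
    rw [mul_one, one_div]; exact (ENNReal.mul_inv_cancel (by simp) (by simp)).symm
  | succ n =>
    have : ∀ d, cons d ⁻¹' cyl (n + 1) a = if d = a 0 then cyl n (tail a) else ∅ := by
      intro d; ext y
      rw [Set.mem_preimage, cons_mem_cyl_succ]
      split_ifs with h <;> simp [h]
    simp only [this]
    rw [Finset.sum_eq_single (a 0)]
    · rw [if_pos rfl, haar_cyl, haar_cyl, pow_succ']
    · intro d _ hd; simp [hd]
    · simp

/-- Integration over the first digit. -/
theorem integral_haar {F : Gam → ℂ} (hF : Measurable F) {K : ℝ} (hK : ∀ x, ‖F x‖ ≤ K) :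
    ∫ x, F x ∂haar = (1 / 3 : ℂ) * ∑ d : Fin 3, ∫ y, F (cons d y) ∂haar := by
  have hint : ∀ d ∈ (Finset.univ : Finset (Fin 3)),
      Integrable F (((1 / 3 : NNReal) : ENNReal) • haar.map (cons d)) := fun d _ =>
    have := Measure.isFiniteMeasure_map haar (cons d)
    (Integrable.of_bound hF.aestronglyMeasurable K (ae_of_all _ hK)).smul_measure (by simp)
  conv_lhs => rw [haar_eq_sum_cons]
  rw [integral_finsetSum_measure hint, Finset.mul_sum]
  refine Finset.sum_congr rfl fun d _ => ?_
  rw [integral_smul_measure, integral_map (measurable_cons d).aemeasurable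
    hF.aestronglyMeasurable]
  simp

theorem measurable_phi : Measurable phi := by
  have : phi = fun x => if phi x = 1 then 1 else 0 := by
    funext x; rcases phi_le_one x with h | h <;> simp [h]
  rw [this]
  exact Measurable.ite measurableSet_phi measurable_const measurable_const

theorem measurable_phiSum (m : ℕ) : Measurable (phiSum m) := by
  unfold phiSum
  exact Finset.measurable_sum _ fun i _ => measurable_phi.comp (measurable_adding.iterate i)

theorem phiSum_le (m : ℕ) (x : Gam) : phiSum m x ≤ m := by
  unfold phiSum
  refine (Finset.sum_le_card_nsmul _ _ 1 fun i _ => ?_).trans (by simp)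
  rcases phi_le_one (adding^[i] x) with h | h <;> omega

theorem phiSum_succ (m : ℕ) (x : Gam) : phiSum (m + 1) x = phiSum m x + phi (adding^[m] x) :=
  Finset.sum_range_succ _ _

theorem phiSum_add (m n : ℕ) (x : Gam) :
    phiSum (m + n) x = phiSum m x + phiSum n (adding^[m] x) := by
  induction n with
  | zero => simp [phiSum]
  | succ n ih =>
    rw [← add_assoc, phiSum_succ, ih, phiSum_succ, add_assoc, ← Function.iterate_add_apply,
      add_comm n m]

/-- Three steps of the adding machine amount to one step on the sequence without its first digit,
and the cocycle collects the digits `0` and `1` and one value of `φ` meanwhile. -/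
theorem adding_three_cons (d : Fin 3) (y : Gam) :
    adding^[3] (cons d y) = cons d (adding y) ∧ phiSum 3 (cons d y) = 1 + phi y := by
  have h0 : ∀ y, adding (cons 0 y) = cons 1 y := fun y => adding_cons 0 (by decide) y
  have h1 : ∀ y, adding (cons 1 y) = cons 2 y := fun y => adding_cons 1 (by decide) y
  have : d = 0 ∨ d = 1 ∨ d = 2 := by revert d; decide
  rcases this with rfl | rfl | rfl <;>
    simp [phiSum, Finset.sum_range_succ, h0, h1, adding_cons_two, phi_cons_zero, phi_cons_one,
      phi_cons_two, add_comm]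

theorem adding_mul_three_cons (m : ℕ) (d : Fin 3) (y : Gam) :
    adding^[3 * m] (cons d y) = cons d (adding^[m] y) := by
  induction m with
  | zero => rfl
  | succ m ih =>
    rw [mul_add, mul_one, add_comm, Function.iterate_add_apply, ih, (adding_three_cons d _).1,
      Function.iterate_succ_apply']

theorem phiSum_mul_three_cons (m : ℕ) (d : Fin 3) (y : Gam) :
    phiSum (3 * m) (cons d y) = m + phiSum m y := by
  induction m with
  | zero => simp [phiSum]
  | succ m ih =>
    rw [mul_add, mul_one, phiSum_add, ih, adding_mul_three_cons, (adding_three_cons d _).2,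
      phiSum_succ]
    ring

/-- `P m` is the generating function of the law of `φ^(m)`. -/
theorem eval_P (m : ℕ) (z : ℂ) : (P m).eval z = ∫ x, z ^ phiSum m x ∂haar := by
  have hm : ∀ s, MeasurableSet {x | phiSum m x = s} := fun s =>
    measurable_phiSum m (measurableSet_singleton s)
  have : ∀ x, z ^ phiSum m x =
      ∑ s ∈ Finset.range (m + 1), {x | phiSum m x = s}.indicator (fun _ => z ^ s) x := by
    intro x
    rw [Finset.sum_eq_single (phiSum m x)]
    · simp
    · intro s _ hs
      exact Set.indicator_of_notMem (fun h => hs (Eq.symm h)) _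
    · intro h; exact absurd (Finset.mem_range.2 (Nat.lt_succ_of_le (phiSum_le m x))) h
  simp only [this]
  rw [integral_finsetSum _ fun s _ => (integrable_const _).indicator (hm s)]
  simp only [P, eval_finsetSum, eval_mul, eval_C, eval_pow, eval_X]
  refine Finset.sum_congr rfl fun s _ => ?_
  rw [integral_indicator_const _ (hm s), dist, Complex.real_smul]

theorem measurable_pow_phiSum (m : ℕ) (z : ℂ) : Measurable fun x => z ^ phiSum m x :=
  (measurable_from_top (f := fun n : ℕ => z ^ n)).comp (measurable_phiSum m)

theorem norm_pow_phiSum_le (m : ℕ) {z : ℂ} (hz : ‖z‖ = 1) (x : Gam) : ‖z ^ phiSum m x‖ ≤ 1 := by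
  simp [hz]

theorem eval_P_eq {z : ℂ} (hz : ‖z‖ = 1) (n : ℕ) {a b c : Gam → ℕ}
    (ha : ∀ y, phiSum n (cons 0 y) = a y) (hb : ∀ y, phiSum n (cons 1 y) = b y)
    (hc : ∀ y, phiSum n (cons 2 y) = c y) :
    (P n).eval z = (1 / 3 : ℂ) *
      (∫ y, z ^ a y ∂haar + ∫ y, z ^ b y ∂haar + ∫ y, z ^ c y ∂haar) := by
  rw [eval_P, integral_haar (measurable_pow_phiSum n z) (norm_pow_phiSum_le n hz),
    Fin.sum_univ_three]
  simp only [ha, hb, hc]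

theorem eval_P_mul_three {z : ℂ} (hz : ‖z‖ = 1) (m : ℕ) :
    (P (3 * m)).eval z = z ^ m * (P m).eval z := by
  rw [eval_P_eq hz (3 * m) (phiSum_mul_three_cons m 0) (phiSum_mul_three_cons m 1)
    (phiSum_mul_three_cons m 2), eval_P]
  simp only [pow_add, integral_const_mul]
  ring

theorem eval_P_mul_three_add_one {z : ℂ} (hz : ‖z‖ = 1) (m : ℕ) :
    (P (3 * m + 1)).eval z =
      z ^ m * ((1 + z) * (P m).eval z + (P (m + 1)).eval z) / 3 := by
  rw [eval_P_eq hz (3 * m + 1) (a := fun y => m + phiSum m y) (b := fun y => m + 1 + phiSum m y)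
    (c := fun y => m + phiSum (m + 1) y), eval_P, eval_P]
  · simp only [pow_add, integral_const_mul]
    ring
  all_goals
    intro y
    rw [phiSum_succ, phiSum_mul_three_cons, adding_mul_three_cons]
  · simp [phi_cons_zero]
  · rw [phi_cons_one]; ring
  · rw [phi_cons_two, phiSum_succ, add_assoc]

theorem eval_P_mul_three_add_two {z : ℂ} (hz : ‖z‖ = 1) (m : ℕ) :
    (P (3 * m + 2)).eval z =
      z ^ m * (z * (P m).eval z + (1 + z) * (P (m + 1)).eval z) / 3 := by
  rw [eval_P_eq hz (3 * m + 2) (a := fun y => m + 1 + phiSum m y)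
    (b := fun y => m + 1 + phiSum (m + 1) y) (c := fun y => m + phiSum (m + 1) y), eval_P, eval_P]
  · simp only [pow_add, integral_const_mul]
    ring
  all_goals
    intro y
    rw [phiSum_succ, phiSum_succ, phiSum_mul_three_cons, Function.iterate_succ_apply',
      adding_mul_three_cons]
  · rw [adding_cons 0 (by decide)]; simp [phi_cons_zero, phi_cons_one]; ring
  · rw [adding_cons 1 (by decide)]
    simp only [show (1 : Fin 3) + 1 = 2 from rfl]
    rw [phi_cons_one, phi_cons_two, phiSum_succ]; ring
  · rw [adding_cons_two, phi_cons_zero, phi_cons_two, phiSum_succ]; ring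

theorem norm_eval_P_le (m : ℕ) {z : ℂ} (hz : ‖z‖ = 1) : ‖(P m).eval z‖ ≤ 1 := by
  rw [eval_P]
  exact (norm_integral_le_of_norm_le_const (ae_of_all _ (norm_pow_phiSum_le m hz))).trans (by simp)

/-! ### Decay of `P m` away from `1` -/

/-- `m_r = a_0 3 ^ r + a_1 3 ^ (r - 1) + ⋯ + a_r`. -/
def lead (a : ℕ → ℕ) : ℕ → ℕ
  | 0 => a 0
  | r + 1 => 3 * lead a r + a (r + 1)

/-- The contraction factor coming from `|1 + z| ≤ 2`. -/
noncomputable def factor (z : ℂ) : ℝ := (1 + ‖1 + z‖) / 3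

theorem factor_le_one {z : ℂ} (hz : ‖z‖ = 1) : factor z ≤ 1 := by
  have := norm_add_le 1 z
  rw [hz, norm_one] at this
  unfold factor; linarith

theorem factor_nonneg (z : ℂ) : 0 ≤ factor z := by unfold factor; positivity

theorem factor_le {z : ℂ} (hz : ‖z‖ = 1) : factor z ≤ 1 - ‖1 - z‖ ^ 2 / 12 := by
  have h : ‖1 + z‖ * ‖1 + z‖ + ‖1 - z‖ * ‖1 - z‖ = 2 * (1 * 1 + 1 * 1) := by
    have := parallelogram_law_with_norm ℝ (1 : ℂ) z
    rw [hz, norm_one] at this; linarith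
  have : ‖1 + z‖ ≤ 2 - ‖1 - z‖ ^ 2 / 4 := by nlinarith [sq_nonneg (‖1 + z‖ - 2)]
  unfold factor; linarith

theorem norm_eval_P_mul_three_add_one_le {z : ℂ} (hz : ‖z‖ = 1) (m : ℕ) {B : ℝ}
    (h0 : ‖(P m).eval z‖ ≤ B) (h1 : ‖(P (m + 1)).eval z‖ ≤ B) :
    ‖(P (3 * m + 1)).eval z‖ ≤ factor z * B := by
  rw [eval_P_mul_three_add_one hz, norm_div, norm_mul, norm_pow, hz, one_pow, one_mul]
  have h2 : ‖(1 + z) * (P m).eval z‖ ≤ ‖1 + z‖ * B := by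
    rw [norm_mul]; gcongr
  have h3 := norm_add_le ((1 + z) * (P m).eval z) ((P (m + 1)).eval z)
  rw [factor, Complex.norm_ofNat]
  linarith

theorem norm_eval_P_mul_three_add_two_le {z : ℂ} (hz : ‖z‖ = 1) (m : ℕ) {B : ℝ}
    (h0 : ‖(P m).eval z‖ ≤ B) (h1 : ‖(P (m + 1)).eval z‖ ≤ B) :
    ‖(P (3 * m + 2)).eval z‖ ≤ factor z * B := by
  rw [eval_P_mul_three_add_two hz, norm_div, norm_mul, norm_pow, hz, one_pow, one_mul]
  have h2 : ‖(1 + z) * (P (m + 1)).eval z‖ ≤ ‖1 + z‖ * B := by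
    rw [norm_mul]; gcongr
  have h3 := norm_add_le (z * (P m).eval z) ((1 + z) * (P (m + 1)).eval z)
  rw [norm_mul z, hz, one_mul] at h3
  rw [factor, Complex.norm_ofNat]
  linarith

theorem norm_eval_P_mul_three {z : ℂ} (hz : ‖z‖ = 1) (m : ℕ) :
    ‖(P (3 * m)).eval z‖ = ‖(P m).eval z‖ := by
  rw [eval_P_mul_three hz, norm_mul, norm_pow, hz, one_pow, one_mul]

/-- A digit different from `0` after `r` contracts `P (m_n)`, and a digit different from `2`
contracts `P (m_n + 1)`, for good. -/
theorem norm_eval_P_lead_le {a : ℕ → ℕ} (ha : ∀ l, a l ≤ 2) {z : ℂ} (hz : ‖z‖ = 1) {B : ℝ}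
    (hB : 0 ≤ B) {r : ℕ} (h0 : ‖(P (lead a r)).eval z‖ ≤ B)
    (h1 : ‖(P (lead a r + 1)).eval z‖ ≤ B) (n : ℕ) (hn : r ≤ n) :
    ‖(P (lead a n)).eval z‖ ≤ B ∧ ‖(P (lead a n + 1)).eval z‖ ≤ B ∧
    ((∃ l ∈ Set.Ioc r n, a l ≠ 0) → ‖(P (lead a n)).eval z‖ ≤ factor z * B) ∧
    ((∃ l ∈ Set.Ioc r n, a l ≠ 2) → ‖(P (lead a n + 1)).eval z‖ ≤ factor z * B) := by
  induction n, hn using Nat.le_induction with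
  | base => exact ⟨h0, h1, by simp, by simp⟩
  | succ n hn ih =>
    obtain ⟨i0, i1, i2, i3⟩ := ih
    have hc : factor z * B ≤ B := mul_le_of_le_one_left hB (factor_le_one hz)
    have e1 := norm_eval_P_mul_three_add_one_le hz (lead a n) i0 i1
    have e2 := norm_eval_P_mul_three_add_two_le hz (lead a n) i0 i1
    have e3 := norm_eval_P_mul_three hz (lead a n)
    have e4 := norm_eval_P_mul_three hz (lead a n + 1)
    rw [show 3 * (lead a n + 1) = 3 * lead a n + 3 by ring] at e4
    have hd : a (n + 1) = 0 ∨ a (n + 1) = 1 ∨ a (n + 1) = 2 := by have := ha (n + 1); omega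
    have hmono : ∀ {c : ℕ}, a (n + 1) = c → (∃ l ∈ Set.Ioc r (n + 1), a l ≠ c) →
        ∃ l ∈ Set.Ioc r n, a l ≠ c := by
      rintro c h ⟨l, ⟨hl, hl'⟩, hne⟩
      refine ⟨l, ⟨hl, ?_⟩, hne⟩
      rcases Nat.lt_succ_iff_lt_or_eq.1 (Nat.lt_succ_of_le hl') with h5 | rfl
      · omega
      · exact absurd h hne
    rcases hd with hd | hd | hd <;> simp only [lead, hd, add_zero, add_assoc, Nat.reduceAdd]
    · exact ⟨e3 ▸ i0, e1.trans hc, fun h => e3 ▸ i2 (hmono hd h), fun _ => e1⟩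
    · exact ⟨e1.trans hc, e2.trans hc, fun _ => e1, fun _ => e2⟩
    · exact ⟨e2.trans hc, e4 ▸ i1, fun _ => e2, fun h => e4 ▸ i3 (hmono hd h)⟩

/-- Each time a digit different from `0` and a digit different from `2` have occurred, both values
gain a factor `factor z`. -/
theorem exists_norm_eval_P_lead_le {a : ℕ → ℕ} (ha : ∀ l, a l ≤ 2) (h2 : {l | a l ≠ 2}.Infinite)
    (h0 : {l | a l ≠ 0}.Infinite) (s : ℕ) : ∃ R, ∀ n ≥ R, ∀ z : ℂ, ‖z‖ = 1 →
      ‖(P (lead a n)).eval z‖ ≤ factor z ^ s ∧ ‖(P (lead a n + 1)).eval z‖ ≤ factor z ^ s := by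
  induction s with
  | zero => exact ⟨0, fun n _ z hz => by simp [norm_eval_P_le _ hz]⟩
  | succ s ih =>
    obtain ⟨R, hR⟩ := ih
    obtain ⟨l, hl, hlR⟩ := h2.exists_gt R
    obtain ⟨l', hl', hlR'⟩ := h0.exists_gt R
    refine ⟨max l l', fun n hn z hz => ?_⟩
    obtain ⟨-, -, i2, i3⟩ := norm_eval_P_lead_le ha hz (pow_nonneg (factor_nonneg z) s)
      (hR R le_rfl z hz).1 (hR R le_rfl z hz).2 n (by omega)
    rw [pow_succ']
    exact ⟨i2 ⟨l', ⟨hlR', by omega⟩, hl'⟩, i3 ⟨l, ⟨hlR, by omega⟩, hl⟩⟩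

/-- If the digits differ from `2` infinitely often and from `0` infinitely often, then
`(1 - z) P (m_n) z` and `(1 - z) P (m_n + 1) z` tend to `0` uniformly on the unit circle. -/
theorem eventually_norm_one_sub_mul_eval_P_lead_le {a : ℕ → ℕ} (ha : ∀ l, a l ≤ 2)
    (h2 : {l | a l ≠ 2}.Infinite) (h0 : {l | a l ≠ 0}.Infinite) {ε : ℝ} (hε : 0 < ε) :
    ∀ᶠ n in atTop, ∀ z : ℂ, ‖z‖ = 1 → ‖(1 - z) * (P (lead a n)).eval z‖ ≤ ε ∧
      ‖(1 - z) * (P (lead a n + 1)).eval z‖ ≤ ε := by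
  wlog hε1 : ε ≤ 1 generalizing ε
  · filter_upwards [this one_pos le_rfl] with n hn z hz
    exact ⟨(hn z hz).1.trans (by linarith), (hn z hz).2.trans (by linarith)⟩
  -- if `‖1 - z‖ ≥ ε`, then `factor z ≤ 1 - ε ^ 2 / 12` uniformly; otherwise `‖1 - z‖` is small itself
  obtain ⟨s, hs⟩ := exists_pow_lt_of_lt_one (half_pos hε)
    (show 1 - ε ^ 2 / 12 < 1 by have := pow_pos hε 2; linarith)
  obtain ⟨R, hR⟩ := exists_norm_eval_P_lead_le ha h2 h0 s
  filter_upwards [eventually_ge_atTop R] with n hn z hz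
  have key : ∀ w : ℂ, ‖w‖ ≤ 1 → ‖w‖ ≤ factor z ^ s → ‖(1 - z) * w‖ ≤ ε := by
    intro w hw1 hw
    rw [norm_mul]
    rcases le_total ‖1 - z‖ ε with h | h
    · exact (mul_le_mul h hw1 (norm_nonneg _) hε.le).trans (by simp)
    · have h3 : ‖1 - z‖ ≤ 2 := (norm_sub_le _ _).trans (by rw [hz, norm_one]; norm_num)
      have h4 : factor z ≤ 1 - ε ^ 2 / 12 := (factor_le hz).trans (by gcongr)
      have h5 := pow_le_pow_left₀ (factor_nonneg z) h4 s
      calc ‖1 - z‖ * ‖w‖ ≤ 2 * (ε / 2) :=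
            mul_le_mul h3 (hw.trans (h5.trans hs.le)) (norm_nonneg _) (by norm_num)
        _ = ε := by ring
  exact ⟨key _ (norm_eval_P_le _ hz) (hR n hn z hz).1, key _ (norm_eval_P_le _ hz) (hR n hn z hz).2⟩

/-! ### Operators on a Hilbert space -/

section Hilbert

variable {H : Type*} [NormedAddCommGroup H] [InnerProductSpace ℂ H]

/-- A uniformly bounded sequence of functionals that tends to `0` on a total set tends to `0`
everywhere. -/
theorem tendsto_zero_of_total {ℓ : ℕ → H →L[ℂ] ℂ} {K : ℝ} (hK : ∀ j, ‖ℓ j‖ ≤ K) {S : Set H}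
    (hS : (Submodule.span ℂ S).topologicalClosure = ⊤)
    (h : ∀ f ∈ S, Tendsto (fun j => ℓ j f) atTop (𝓝 0)) (f : H) :
    Tendsto (fun j => ℓ j f) atTop (𝓝 0) := by
  have hspan : ∀ f ∈ Submodule.span ℂ S, Tendsto (fun j => ℓ j f) atTop (𝓝 0) := by
    intro f hf
    induction hf using Submodule.span_induction with
    | mem f hf => exact h f hf
    | zero => simp
    | add f g _ _ hf hg => simpa using hf.add hg
    | smul c f _ hf => simpa using hf.const_mul c
  have hf : f ∈ (Submodule.span ℂ S).topologicalClosure := hS ▸ Submodule.mem_top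
  have hK0 : 0 ≤ K := (norm_nonneg _).trans (hK 0)
  rw [NormedAddGroup.tendsto_nhds_zero]
  intro ε hε
  obtain ⟨g, hg, hfg⟩ := Metric.mem_closure_iff.1 hf (ε / 2 / (K + 1)) (by positivity)
  filter_upwards [NormedAddGroup.tendsto_nhds_zero.1 (hspan g hg) (ε / 2) (half_pos hε)]
    with j hj
  rw [dist_eq_norm] at hfg
  calc ‖ℓ j f‖ = ‖ℓ j (f - g) + ℓ j g‖ := by rw [map_sub, sub_add_cancel]
    _ ≤ K * ‖f - g‖ + ‖ℓ j g‖ :=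
      (norm_add_le _ _).trans (add_le_add_left (ContinuousLinearMap.le_of_opNorm_le _ (hK j) _) _)
    _ < ε / 2 + ε / 2 := by
      refine add_lt_add_of_le_of_lt ?_ hj
      calc K * ‖f - g‖ ≤ (K + 1) * (ε / 2 / (K + 1)) := by gcongr; linarith
        _ = ε / 2 := by field_simp
    _ = ε := add_halves ε

/-- Weak convergence to `0` of a bounded sequence of operators can be checked on a total set. -/
theorem tendsto_inner_zero_of_total {A : ℕ → H →L[ℂ] H} {K : ℝ} (hK : ∀ j, ‖A j‖ ≤ K) {S : Set H}
    (hS : (Submodule.span ℂ S).topologicalClosure = ⊤)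
    (h : ∀ f ∈ S, ∀ g ∈ S, Tendsto (fun j => inner ℂ g (A j f)) atTop (𝓝 0)) (f g : H) :
    Tendsto (fun j => inner ℂ g (A j f)) atTop (𝓝 0) := by
  have hK0 : 0 ≤ K := (norm_nonneg _).trans (hK 0)
  have h1 : ∀ g ∈ S, ∀ f, Tendsto (fun j => inner ℂ g (A j f)) atTop (𝓝 0) := by
    intro g hg f
    refine tendsto_zero_of_total (ℓ := fun j => (innerSL ℂ g).comp (A j)) (K := ‖g‖ * K)
      (fun j => ?_) hS (fun f hf => h f hf g hg) f
    refine (ContinuousLinearMap.opNorm_comp_le _ _).trans ?_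
    rw [innerSL_apply_norm]
    exact mul_le_mul_of_nonneg_left (hK j) (norm_nonneg _)
  have h2 : Tendsto (fun j => inner ℂ (A j f) g) atTop (𝓝 0) := by
    refine tendsto_zero_of_total (ℓ := fun j => innerSL ℂ (A j f)) (K := K * ‖f‖)
      (fun j => ?_) hS (fun g hg => ?_) g
    · rw [innerSL_apply_norm]
      exact ContinuousLinearMap.le_of_opNorm_le _ (hK j) f
    · have := (Complex.continuous_conj.tendsto _).comp (h1 g hg f)
      simpa [Function.comp_def] using this
  have := (Complex.continuous_conj.tendsto _).comp h2
  simpa [Function.comp_def] using this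

theorem cauchySeq_of_approx {u : ℕ → ℂ}
    (h : ∀ ε > 0, ∃ v : ℕ → ℂ, CauchySeq v ∧ ∀ j, Dist.dist (u j) (v j) ≤ ε) : CauchySeq u := by
  rw [Metric.cauchySeq_iff]
  intro ε hε
  obtain ⟨v, hv, huv⟩ := h (ε / 3) (by positivity)
  obtain ⟨N, hN⟩ := Metric.cauchySeq_iff.1 hv (ε / 3) (by positivity)
  refine ⟨N, fun m hm n hn => ?_⟩
  have h1 := dist_triangle4 (u m) (v m) (v n) (u n)
  have h2 := huv n
  rw [dist_comm] at h2
  linarith [huv m, hN m hm n hn]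

variable [CompleteSpace H]

/-- A polynomial in a unitary operator is bounded by the supremum of the polynomial on the unit
circle: by the continuous functional calculus. -/
theorem norm_aeval_le_of_unitary {U : H →L[ℂ] H} (hU : U ∈ unitary (H →L[ℂ] H)) (p : ℂ[X]) {K : ℝ}
    (hK : 0 ≤ K) (hp : ∀ z : ℂ, ‖z‖ = 1 → ‖p.eval z‖ ≤ K) : ‖aeval U p‖ ≤ K := by
  have hn : IsStarNormal U := ⟨hU.1.trans hU.2.symm⟩
  rw [← cfc_polynomial p U hn]
  exact norm_cfc_le hK fun z hz =>
    hp z (by simpa using spectrum.subset_circle_of_unitary hU hz)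

/-- If `‖p n‖ ≤ 1` and `(1 - z) p n z → 0` uniformly on the unit circle, then `(p n U)†` tends to
`0` strongly on the orthogonal of the vectors fixed by the unitary operator `U`. -/
theorem tendsto_adjoint_aeval {U : H →L[ℂ] H} (hU : U ∈ unitary (H →L[ℂ] H)) {p : ℕ → ℂ[X]}
    (hp : ∀ n, ∀ z : ℂ, ‖z‖ = 1 → ‖(p n).eval z‖ ≤ 1)
    (hp' : ∀ ε > 0, ∀ᶠ n in atTop, ∀ z : ℂ, ‖z‖ = 1 → ‖(1 - z) * (p n).eval z‖ ≤ ε) {g : H}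
    (hg : g ∈ (1 - U).kerᗮ) :
    Tendsto (fun n => (aeval U (p n)).adjoint g) atTop (𝓝 0) := by
  rw [ContinuousLinearMap.orthogonal_ker] at hg
  rw [NormedAddGroup.tendsto_nhds_zero]
  intro ε hε
  obtain ⟨_, ⟨u, rfl⟩, hu⟩ := Metric.mem_closure_iff.1 hg (ε / 2) (half_pos hε)
  filter_upwards [hp' (ε / 2 / (‖u‖ + 1)) (by positivity)] with n hn
  have h1 : ‖(aeval U (p n)).adjoint‖ ≤ 1 := by
    rw [LinearIsometryEquiv.norm_map]
    exact norm_aeval_le_of_unitary hU _ zero_le_one (hp n)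
  have h2 : ‖(aeval U ((1 - X) * p n)).adjoint‖ ≤ ε / 2 / (‖u‖ + 1) := by
    rw [LinearIsometryEquiv.norm_map]
    exact norm_aeval_le_of_unitary hU _ (by positivity) (by simpa using hn)
  have h3 : (aeval U (p n)).adjoint ((1 - U).adjoint u) =
      (aeval U ((1 - X) * p n)).adjoint u := by
    have h5 : aeval U ((1 - X) * p n) = (1 - U).comp (aeval U (p n)) := by simp; rfl
    rw [h5, ContinuousLinearMap.adjoint_comp]
    rfl
  have h4 : (aeval U (p n)).adjoint g =
      (aeval U (p n)).adjoint (g - (1 - U).adjoint u) + (aeval U ((1 - X) * p n)).adjoint u := by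
    rw [map_sub, h3, sub_add_cancel]
  rw [h4]
  rw [dist_eq_norm] at hu
  calc _ ≤ 1 * ‖g - (1 - U).adjoint u‖ + ε / 2 / (‖u‖ + 1) * ‖u‖ :=
        (norm_add_le _ _).trans (add_le_add (ContinuousLinearMap.le_of_opNorm_le _ h1 _)
          (ContinuousLinearMap.le_of_opNorm_le _ h2 _))
    _ < ε / 2 + ε / 2 := by
      refine add_lt_add_of_lt_of_le (by simpa using hu) ?_
      rw [div_mul_eq_mul_div, div_le_iff₀ (by positivity)]
      gcongr; linarith
    _ = ε := add_halves ε

/-- The closed unit ball of the bounded operators of a separable Hilbert space is sequentially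
compact in the weak operator topology. -/
theorem exists_subseq_weak_tendsto [TopologicalSpace.SeparableSpace H] {A : ℕ → H →L[ℂ] H}
    (hA : ∀ j, ‖A j‖ ≤ 1) : ∃ (ψ : ℕ → ℕ) (L : H →L[ℂ] H), StrictMono ψ ∧
      ∀ f g, Tendsto (fun j => inner ℂ g (A (ψ j) f)) atTop (𝓝 (inner ℂ g (L f))) := by
  have hbound : ∀ j f g, ‖inner ℂ (A j f) g‖ ≤ ‖f‖ * ‖g‖ := fun j f g =>
    (norm_inner_le_norm _ _).trans (mul_le_mul_of_nonneg_right
      (by simpa using ContinuousLinearMap.le_of_opNorm_le _ (hA j) f) (norm_nonneg _))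
  have hx := TopologicalSpace.denseRange_denseSeq H
  set x := TopologicalSpace.denseSeq H
  -- the extraction is made on the countable family of pairs taken from a dense sequence
  obtain ⟨G, -, ψ, hψ, hG⟩ := (isCompact_univ_pi fun i : ℕ × ℕ =>
    isCompact_closedBall (0 : ℂ) (‖x i.1‖ * ‖x i.2‖)).tendsto_subseq
      (x := fun j i => inner ℂ (A j (x i.1)) (x i.2))
      (fun j i _ => by simpa using hbound j (x i.1) (x i.2))
  rw [tendsto_pi_nhds] at hG
  have happ : ∀ (f : H) (δ : ℝ), 0 < δ → ∃ a, ‖f - x a‖ < δ := fun f δ hδ => by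
    obtain ⟨a, ha⟩ := hx.exists_dist_lt f hδ
    exact ⟨a, by rwa [← dist_eq_norm]⟩
  have hc1 : ∀ a g, CauchySeq fun j => inner ℂ (A (ψ j) (x a)) g := by
    refine fun a g => cauchySeq_of_approx fun ε hε => ?_
    obtain ⟨b, hb⟩ := happ g (ε / (‖x a‖ + 1)) (by positivity)
    refine ⟨_, (hG (a, b)).cauchySeq, fun j => ?_⟩
    simp only [Function.comp_apply]
    rw [dist_eq_norm, ← inner_sub_right]
    refine (hbound _ _ _).trans ?_
    calc _ ≤ (‖x a‖ + 1) * (ε / (‖x a‖ + 1)) := by gcongr; linarith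
      _ = ε := by field_simp
  have hc : ∀ f g, CauchySeq fun j => inner ℂ (A (ψ j) f) g := by
    refine fun f g => cauchySeq_of_approx fun ε hε => ?_
    obtain ⟨a, ha⟩ := happ f (ε / (‖g‖ + 1)) (by positivity)
    refine ⟨_, hc1 a g, fun j => ?_⟩
    rw [dist_eq_norm, ← inner_sub_left, ← map_sub]
    refine (hbound _ _ _).trans ?_
    calc _ ≤ (ε / (‖g‖ + 1)) * (‖g‖ + 1) := by gcongr; linarith
      _ = ε := by field_simp
  choose B hB using fun f g => cauchySeq_tendsto_of_complete (hc f g)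
  have hBn : ∀ f g, ‖B f g‖ ≤ 1 * ‖f‖ * ‖g‖ := fun f g => by
    rw [one_mul]
    exact le_of_tendsto (hB f g).norm (Eventually.of_forall fun j => hbound _ f g)
  let B' : H →ₗ⋆[ℂ] H →ₗ[ℂ] ℂ := LinearMap.mk₂'ₛₗ (starRingEnd ℂ) (RingHom.id ℂ) B
    (fun f f' g => tendsto_nhds_unique (hB _ _) (by
      simpa [inner_add_left] using (hB f g).add (hB f' g)))
    (fun c f g => tendsto_nhds_unique (hB _ _) (by
      simpa [inner_smul_left, mul_comm] using (hB f g).const_mul (starRingEnd ℂ c)))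
    (fun f g g' => tendsto_nhds_unique (hB _ _) (by
      simpa [inner_add_right] using (hB f g).add (hB f g')))
    (fun c f g => tendsto_nhds_unique (hB _ _) (by
      simpa [inner_smul_right] using (hB f g).const_mul c))
  refine ⟨ψ, InnerProductSpace.continuousLinearMapOfBilin (B'.mkContinuous₂ 1 hBn), hψ,
    fun f g => ?_⟩
  have h1 : inner ℂ (InnerProductSpace.continuousLinearMapOfBilin (B'.mkContinuous₂ 1 hBn) f) g
      = B f g := by
    rw [InnerProductSpace.continuousLinearMapOfBilin_apply]; rfl
  have := (Complex.continuous_conj.tendsto _).comp (hB f g)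
  rw [← h1, inner_conj_symm] at this
  simpa only [Function.comp_def, inner_conj_symm] using this

end Hilbert

/-! ### Towers and the coordinates of their bases -/

section Towers

variable {X : Type*} [MeasurableSpace X]

theorem fin_three_cases (d : Fin 3) : d = 0 ∨ d = 1 ∨ d = 2 := by revert d; decide

/-- The power `T ^ n`, `n ∈ ℤ`. -/
def tpow (T : X ≃ᵐ X) (n : ℤ) : X → X := ⇑((T.toEquiv : Equiv.Perm X) ^ n)

theorem tpow_zero (T : X ≃ᵐ X) (x : X) : tpow T 0 x = x := by simp [tpow]

theorem tpow_add (T : X ≃ᵐ X) (a b : ℤ) (x : X) : tpow T (a + b) x = tpow T a (tpow T b x) := by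
  simp [tpow, zpow_add]

theorem tpow_natCast (T : X ≃ᵐ X) (n : ℕ) (x : X) : tpow T n x = T^[n] x := by
  simp only [tpow, zpow_natCast, Equiv.Perm.coe_pow]; rfl

theorem tpow_neg_tpow (T : X ≃ᵐ X) (a : ℤ) (x : X) : tpow T (-a) (tpow T a x) = x := by
  rw [← tpow_add, neg_add_cancel, tpow_zero]

theorem tpow_tpow_neg (T : X ≃ᵐ X) (a : ℤ) (x : X) : tpow T a (tpow T (-a) x) = x := by
  rw [← tpow_add, add_neg_cancel, tpow_zero]

theorem measurePreserving_tpow {T : X ≃ᵐ X} {μ : Measure X} (hT : MeasurePreserving T μ μ) (n : ℤ) :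
    MeasurePreserving (tpow T n) μ μ := by
  obtain ⟨n, rfl | rfl⟩ := n.eq_nat_or_neg
  · have : tpow T n = T^[n] := funext (tpow_natCast T n)
    rw [this]; exact hT.iterate n
  · have : tpow T (-n) = T.symm^[n] := by
      funext x
      have h : T^[n] (T.symm^[n] x) = x :=
        Function.RightInverse.iterate (fun x => T.apply_symm_apply x) n x
      conv_lhs => rw [← h, ← tpow_natCast, tpow_neg_tpow]
    rw [this]; exact (hT.symm T).iterate n

/-- The set `T ^ i (E n)`, `i ∈ ℤ`; for `0 ≤ i < height n` it is a level of Tower `n`. -/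
def lev (T : X ≃ᵐ X) (E : ℕ → Set X) (n : ℕ) (i : ℤ) : Set X := {x | tpow T (-i) x ∈ E n}

theorem tpow_mem_lev (T : X ≃ᵐ X) (E : ℕ → Set X) (n : ℕ) (i a : ℤ) (x : X) :
    tpow T a x ∈ lev T E n i ↔ x ∈ lev T E n (i - a) := by
  simp only [lev, Set.mem_ofPred_eq]
  rw [← tpow_add, show -i + a = -(i - a) by ring]

theorem lev_zero (T : X ≃ᵐ X) (E : ℕ → Set X) (n : ℕ) : lev T E n 0 = E n := by
  ext x; simp [lev, tpow_zero]

theorem lev_natCast (T : X ≃ᵐ X) (E : ℕ → Set X) (n i : ℕ) : lev T E n i = T^[i] '' E n := by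
  ext x
  constructor
  · intro h
    exact ⟨_, h, by rw [← tpow_natCast, tpow_tpow_neg]⟩
  · rintro ⟨y, hy, rfl⟩
    rw [← tpow_natCast, tpow_mem_lev, sub_self, lev_zero]
    exact hy

/-- The sets `E n` are the bases of the towers of a Chacon automorphism. -/
structure IsTowers (T : X ≃ᵐ X) (μ : Measure X) (E : ℕ → Set X) : Prop where
  measurePreserving : MeasurePreserving T μ μ
  measurableSet_base : ∀ n, MeasurableSet (E n)
  disjoint_image : ∀ n, ∀ i < height n, ∀ j < height n, i ≠ j →
    Disjoint (T^[i] '' E n) (T^[j] '' E n)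
  base_eq : ∀ n, E n = E (n + 1) ∪ T^[height n] '' E (n + 1) ∪ T^[2 * height n + 1] '' E (n + 1)
  exhaust : ∀ A : Set X, MeasurableSet A → ∀ ε > 0, ∃ n, ∃ s ⊆ Finset.range (height n),
      μ (symmDiff A (⋃ i ∈ s, T^[i] '' E n)) < ε

theorem IsChacon.exists_isTowers {T : X ≃ᵐ X} {μ : Measure X} (h : IsChacon T μ) :
    ∃ E, IsTowers T μ E := by
  obtain ⟨E, h1, h2, h3, h4⟩ := h.exists_towers
  exact ⟨E, h.measurePreserving, h1, h2, h3, h4⟩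

/-- The heights, in Tower `n`, of the three copies of the base of Tower `n + 1`. -/
def offset (n : ℕ) (d : Fin 3) : ℕ := if d = 0 then 0 else if d = 1 then height n else
  2 * height n + 1

theorem height_pos (n : ℕ) : 0 < height n := by
  cases n <;> simp [height]

open Classical in
/-- The index of the sub-column of Tower `n` in which a point of `E n` lies (a junk value off
`E n`). -/
noncomputable def dig (T : X ≃ᵐ X) (E : ℕ → Set X) (n : ℕ) (x : X) : Fin 3 :=
  if x ∈ E (n + 1) then 0 else if x ∈ lev T E (n + 1) (height n) then 1 else 2

/-- The point of `E (n + 1)` in the fibre of the given point of `E n`. -/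
noncomputable def down (T : X ≃ᵐ X) (E : ℕ → Set X) (n : ℕ) (x : X) : X :=
  tpow T (-(offset n (dig T E n x))) x

/-- The `l`-th coordinate of a point of `E n`: the sub-column of Tower `n + l` in which it lies. -/
noncomputable def coord (T : X ≃ᵐ X) (E : ℕ → Set X) : ℕ → ℕ → X → Fin 3
  | 0, n, x => dig T E n x
  | l + 1, n, x => coord T E l (n + 1) (down T E n x)

/-- The coordinates of a point of `E n`, as a point of `Γ`. -/
noncomputable def coords (T : X ≃ᵐ X) (E : ℕ → Set X) (n : ℕ) (x : X) : Gam :=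
  fun l => coord T E l n x

theorem coords_eq_cons (T : X ≃ᵐ X) (E : ℕ → Set X) (n : ℕ) (x : X) :
    coords T E n x = cons (dig T E n x) (coords T E (n + 1) (down T E n x)) := by
  funext l
  cases l <;> rfl

namespace IsTowers

variable {T : X ≃ᵐ X} {μ : Measure X} {E : ℕ → Set X}

theorem measurableSet_lev (h : IsTowers T μ E) (n : ℕ) (i : ℤ) : MeasurableSet (lev T E n i) :=
  (measurePreserving_tpow h.measurePreserving _).measurable (h.measurableSet_base n)

theorem measure_lev (h : IsTowers T μ E) (n : ℕ) (i : ℤ) : μ (lev T E n i) = μ (E n) :=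
  (measurePreserving_tpow h.measurePreserving _).measure_preimage
    (h.measurableSet_base n).nullMeasurableSet

theorem disjoint_lev (h : IsTowers T μ E) {n : ℕ} {i j : ℤ} (hi : 0 ≤ i) (hi' : i < height n)
    (hj : 0 ≤ j) (hj' : j < height n) (hij : i ≠ j) : Disjoint (lev T E n i) (lev T E n j) := by
  lift i to ℕ using hi
  lift j to ℕ using hj
  rw [lev_natCast, lev_natCast]
  exact h.disjoint_image n i (by omega) j (by omega) (by omega)

theorem mem_base_iff (h : IsTowers T μ E) (n : ℕ) (x : X) :
    x ∈ E n ↔ ∃ d, x ∈ lev T E (n + 1) (offset n d) := by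
  rw [h.base_eq n, ← lev_natCast, ← lev_natCast]
  constructor
  · rintro ((h | h) | h)
    · exact ⟨0, by simpa [offset, lev_zero] using h⟩
    · exact ⟨1, by simpa [offset] using h⟩
    · exact ⟨2, by simpa [offset] using h⟩
  · rintro ⟨d, hd⟩
    have := fin_three_cases d
    rcases this with rfl | rfl | rfl
    · exact Or.inl (Or.inl (by simpa [offset, lev_zero] using hd))
    · exact Or.inl (Or.inr (by simpa [offset] using hd))
    · exact Or.inr (by simpa [offset] using hd)

theorem disjoint_lev_offset (h : IsTowers T μ E) (n : ℕ) {i j : ℤ} (hi : 0 ≤ i)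
    (hi' : i < height n) (hj : 0 ≤ j) (hj' : j < height n) {d e : Fin 3} (hde : i ≠ j ∨ d ≠ e) :
    Disjoint (lev T E (n + 1) (i + offset n d)) (lev T E (n + 1) (j + offset n e)) := by
  have h1 : height (n + 1) = 3 * height n + 1 := rfl
  have hd := fin_three_cases d
  have he := fin_three_cases e
  have h2 : (offset n d : ℤ) ≤ 2 * height n + 1 := by
    rcases hd with rfl | rfl | rfl <;> simp [offset] <;> omega
  have h3 : (offset n e : ℤ) ≤ 2 * height n + 1 := by
    rcases he with rfl | rfl | rfl <;> simp [offset] <;> omega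
  refine h.disjoint_lev (by omega) (by omega) (by omega) (by omega) ?_
  rcases hd with rfl | rfl | rfl <;> rcases he with rfl | rfl | rfl <;>
    simp [offset] at hde ⊢ <;> omega

theorem dig_eq (h : IsTowers T μ E) {n : ℕ} {d : Fin 3} {x : X}
    (hx : x ∈ lev T E (n + 1) (offset n d)) : dig T E n x = d := by
  have key : ∀ e, e ≠ d → x ∉ lev T E (n + 1) (offset n e) := fun e he hxe => by
    have := height_pos n
    have := h.disjoint_lev_offset n (i := 0) (j := 0) le_rfl (by omega) le_rfl (by omega)
      (Or.inr he)
    rw [zero_add, zero_add] at this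
    exact Set.disjoint_left.1 this hxe hx
  have hd := fin_three_cases d
  have k0 := key 0
  have k1 := key 1
  simp only [offset, one_ne_zero, if_true, if_false, Nat.cast_zero, lev_zero] at k0 k1
  rcases hd with rfl | rfl | rfl
  · have : x ∈ E (n + 1) := by simpa [offset, lev_zero] using hx
    simp [dig, this]
  · have h1 : x ∈ lev T E (n + 1) (height n) := by simpa [offset] using hx
    rw [dig, if_neg (k0 (by decide)), if_pos h1]
  · rw [dig, if_neg (k0 (by decide)), if_neg (k1 (by decide))]

theorem mem_lev_dig (h : IsTowers T μ E) {n : ℕ} {x : X} (hx : x ∈ E n) :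
    x ∈ lev T E (n + 1) (offset n (dig T E n x)) := by
  obtain ⟨d, hd⟩ := (h.mem_base_iff n x).1 hx
  rwa [h.dig_eq hd]

theorem down_mem (h : IsTowers T μ E) {n : ℕ} {x : X} (hx : x ∈ E n) :
    down T E n x ∈ E (n + 1) := h.mem_lev_dig hx

theorem tpow_offset_mem_lev {n : ℕ} {y : X} (hy : y ∈ E (n + 1)) (d : Fin 3) :
    tpow T (offset n d) y ∈ lev T E (n + 1) (offset n d) := by
  rw [tpow_mem_lev, sub_self, lev_zero]; exact hy

theorem tpow_offset_mem (h : IsTowers T μ E) {n : ℕ} {y : X} (hy : y ∈ E (n + 1)) (d : Fin 3) :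
    tpow T (offset n d) y ∈ E n :=
  (h.mem_base_iff n _).2 ⟨d, tpow_offset_mem_lev hy d⟩

theorem coords_tpow_offset (h : IsTowers T μ E) {n : ℕ} {y : X} (hy : y ∈ E (n + 1)) (d : Fin 3) :
    coords T E n (tpow T (offset n d) y) = cons d (coords T E (n + 1) y) := by
  have : dig T E n (tpow T (offset n d) y) = d := h.dig_eq (tpow_offset_mem_lev hy d)
  rw [coords_eq_cons, down, this, tpow_neg_tpow]

theorem measurable_dig (h : IsTowers T μ E) (n : ℕ) : Measurable (dig T E n) :=
  .ite (h.measurableSet_base _) measurable_const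
    (.ite (h.measurableSet_lev _ _) measurable_const measurable_const)

theorem measurable_down (h : IsTowers T μ E) (n : ℕ) : Measurable (down T E n) := by
  have hm := fun a => (measurePreserving_tpow h.measurePreserving a).measurable
  have : down T E n = fun x => if dig T E n x = 0 then tpow T (-(offset n 0)) x else
      if dig T E n x = 1 then tpow T (-(offset n 1)) x else tpow T (-(offset n 2)) x := by
    funext x
    have hd := fin_three_cases (dig T E n x)
    rcases hd with hd | hd | hd <;> simp [down, hd]
  rw [this]
  exact .ite (h.measurable_dig n (measurableSet_singleton 0)) (hm _)
    (.ite (h.measurable_dig n (measurableSet_singleton 1)) (hm _) (hm _))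

theorem measurable_coords (h : IsTowers T μ E) (n : ℕ) : Measurable (coords T E n) := by
  refine measurable_pi_lambda _ fun l => ?_
  simp only [coords]
  induction l generalizing n with
  | zero => exact h.measurable_dig n
  | succ l ih => exact (ih (n + 1)).comp (h.measurable_down n)

theorem measure_base (h : IsTowers T μ E) (n : ℕ) : μ (E n) = 3 * μ (E (n + 1)) := by
  have h1 : E n = ⋃ d : Fin 3, lev T E (n + 1) (offset n d) := by
    ext x; rw [h.mem_base_iff]; simp
  rw [h1, measure_iUnion, tsum_fintype]
  · simp [h.measure_lev]
  · intro d e hde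
    have := height_pos n
    have := h.disjoint_lev_offset n (i := 0) (j := 0) le_rfl (by omega) le_rfl (by omega)
      (Or.inr hde)
    rwa [zero_add, zero_add] at this
  · exact fun d => h.measurableSet_lev _ _

theorem measure_coords_cyl (h : IsTowers T μ E) (l n : ℕ) (a : Gam) :
    μ (E n ∩ coords T E n ⁻¹' cyl l a) = (1 / 3) ^ l * μ (E n) := by
  induction l generalizing n a with
  | zero =>
    have : cyl 0 a = Set.univ := by ext; simp [cyl]
    simp [this]
  | succ l ih =>
    have h1 : E n ∩ coords T E n ⁻¹' cyl (l + 1) a = tpow T (-(offset n (a 0))) ⁻¹'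
        (E (n + 1) ∩ coords T E (n + 1) ⁻¹' cyl l (tail a)) := by
      ext x
      constructor
      · rintro ⟨hx, hxa⟩
        rw [Set.mem_preimage, coords_eq_cons, cons_mem_cyl_succ] at hxa
        rw [Set.mem_preimage, ← hxa.1]
        exact ⟨h.down_mem hx, hxa.2⟩
      · rintro ⟨hx, hxa⟩
        have h2 := h.tpow_offset_mem hx (a 0)
        have h3 := h.coords_tpow_offset hx (a 0)
        rw [tpow_tpow_neg] at h2 h3
        refine ⟨h2, ?_⟩
        rw [Set.mem_preimage, h3, cons_mem_cyl_succ]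
        exact ⟨rfl, hxa⟩
    rw [h1, (measurePreserving_tpow h.measurePreserving _).measure_preimage
      ((h.measurableSet_base _).inter
        (h.measurable_coords _ (measurableSet_cyl _ _))).nullMeasurableSet, ih, h.measure_base n,
      pow_succ, mul_assoc, ← mul_assoc (1 / 3 : ENNReal) 3, one_div,
      ENNReal.inv_mul_cancel (by simp) (by simp), one_mul]

/-- The coordinates of the points of the base of a tower are uniformly distributed. -/
theorem map_coords [IsFiniteMeasure μ] (h : IsTowers T μ E) (n : ℕ) :
    (μ.restrict (E n)).map (coords T E n) = μ (E n) • haar := by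
  refine measure_ext_cyl fun l a => ?_
  rw [Measure.map_apply (h.measurable_coords n) (measurableSet_cyl l a),
    Measure.restrict_apply (h.measurable_coords n (measurableSet_cyl l a)), Set.inter_comm,
    h.measure_coords_cyl, Measure.smul_apply, haar_cyl, smul_eq_mul, mul_comm]

theorem measure_coords [IsFiniteMeasure μ] (h : IsTowers T μ E) (n : ℕ) {A : Set Gam}
    (hA : MeasurableSet A) : μ (E n ∩ coords T E n ⁻¹' A) = μ (E n) * haar A := by
  rw [Set.inter_comm, ← Measure.restrict_apply (h.measurable_coords n hA),
    ← Measure.map_apply (h.measurable_coords n) hA, h.map_coords]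
  rfl

theorem exists_eq_tpow_offset (h : IsTowers T μ E) {n : ℕ} {y : X} (hy : y ∈ E n) :
    ∃ d, ∃ w ∈ E (n + 1), y = tpow T (offset n d) w :=
  ⟨dig T E n y, down T E n y, h.down_mem hy, (tpow_tpow_neg T _ y).symm⟩

theorem first_return_zero (h : IsTowers T μ E) {n : ℕ} {w : X} (hw : w ∈ E (n + 1)) :
    tpow T (height n + phi (cons 0 (coords T E (n + 1) w))) (tpow T (offset n 0) w) ∈ E n ∧
    coords T E n (tpow T (height n + phi (cons 0 (coords T E (n + 1) w))) (tpow T (offset n 0) w)) =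
      adding (cons 0 (coords T E (n + 1) w)) := by
  have e : tpow T (height n) (tpow T (offset n 0) w) = tpow T (offset n 1) w := by
    rw [← tpow_add]; simp [offset]
  rw [phi_cons_zero, adding_cons 0 (by decide), Nat.cast_zero, add_zero, e]
  exact ⟨h.tpow_offset_mem hw 1, h.coords_tpow_offset hw 1⟩

theorem first_return_one (h : IsTowers T μ E) {n : ℕ} {w : X} (hw : w ∈ E (n + 1)) :
    tpow T (height n + phi (cons 1 (coords T E (n + 1) w))) (tpow T (offset n 1) w) ∈ E n ∧
    coords T E n (tpow T (height n + phi (cons 1 (coords T E (n + 1) w))) (tpow T (offset n 1) w)) =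
      adding (cons 1 (coords T E (n + 1) w)) := by
  have e : tpow T (height n + 1) (tpow T (offset n 1) w) = tpow T (offset n 2) w := by
    rw [← tpow_add]; simp only [offset]; simp; congr 1; ring
  rw [phi_cons_one, adding_cons 1 (by decide), Nat.cast_one, e]
  exact ⟨h.tpow_offset_mem hw 2, h.coords_tpow_offset hw 2⟩

/-- The first return to the base of Tower `n` takes the time `height n + φ`, and acts on the
coordinates as the adding machine. -/
theorem first_return (h : IsTowers T μ E) (p : ℕ) {n : ℕ} {y : X} (hy : y ∈ E n)
    (hp : coords T E n y p ≠ 2) :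
    tpow T (height n + phi (coords T E n y)) y ∈ E n ∧
    coords T E n (tpow T (height n + phi (coords T E n y)) y) = adding (coords T E n y) := by
  induction p generalizing n y with
  | zero =>
    obtain ⟨d, w, hw, rfl⟩ := h.exists_eq_tpow_offset hy
    rw [h.coords_tpow_offset hw] at hp ⊢
    rcases fin_three_cases d with rfl | rfl | rfl
    · exact h.first_return_zero hw
    · exact h.first_return_one hw
    · exact absurd rfl hp
  | succ p ih =>
    obtain ⟨d, w, hw, rfl⟩ := h.exists_eq_tpow_offset hy
    rw [h.coords_tpow_offset hw] at hp ⊢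
    rcases fin_three_cases d with rfl | rfl | rfl
    · exact h.first_return_zero hw
    · exact h.first_return_one hw
    · obtain ⟨i1, i2⟩ := ih hw hp
      have e : tpow T (height n + phi (coords T E (n + 1) w)) (tpow T (offset n 2) w) =
          tpow T (offset n 0) (tpow T (height (n + 1) + phi (coords T E (n + 1) w)) w) := by
        rw [← tpow_add, ← tpow_add]
        congr 1
        simp [offset, height]; ring
      rw [phi_cons_two, adding_cons_two, e]
      exact ⟨h.tpow_offset_mem i1 0, by rw [h.coords_tpow_offset i1 0, i2]⟩

/-- The `m`-th return to the base of Tower `n`. -/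
theorem iterated_return (h : IsTowers T μ E) {n : ℕ} {y : X} (hy : y ∈ E n)
    (hc : ∀ i, adding^[i] (coords T E n y) ≠ fun _ => 2) (m : ℕ) :
    tpow T (m * height n + phiSum m (coords T E n y)) y ∈ E n ∧
    coords T E n (tpow T (m * height n + phiSum m (coords T E n y)) y) =
      adding^[m] (coords T E n y) := by
  induction m with
  | zero => simpa [phiSum, tpow_zero] using hy
  | succ m ih =>
    obtain ⟨i1, i2⟩ := ih
    obtain ⟨p, hp⟩ := Function.ne_iff.1 (hc m)
    rw [← i2] at hp
    obtain ⟨r1, r2⟩ := h.first_return p i1 hp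
    rw [← tpow_add, i2] at r1 r2
    have e : (((m + 1 : ℕ) : ℤ) * height n + phiSum (m + 1) (coords T E n y) : ℤ) =
        height n + phi (adding^[m] (coords T E n y)) +
          (m * height n + phiSum m (coords T E n y)) := by
      rw [phiSum_succ]; push_cast; ring
    rw [e, Function.iterate_succ_apply']
    exact ⟨r1, r2⟩

theorem haar_singleton (c : Gam) : haar {c} = 0 := by
  refine le_antisymm (ge_of_tendsto' (ENNReal.tendsto_pow_atTop_nhds_zero_of_lt_one (r := 1 / 3) (by
    rw [one_div]; exact ENNReal.inv_lt_one.2 (by norm_num))) fun n => ?_) zero_le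
  rw [← haar_cyl n c]
  exact measure_mono (by rintro _ rfl; simp [cyl])

/-- Almost no point of `E n` has an orbit of coordinates that meets the point `222…`, where `φ` is
defined by convention only. -/
theorem ae_coords_ne [IsFiniteMeasure μ] (h : IsTowers T μ E) (n : ℕ) :
    ∀ᵐ y ∂μ, y ∈ E n → ∀ i, adding^[i] (coords T E n y) ≠ fun _ => 2 := by
  have h1 : ∀ i, MeasurableSet (adding^[i] ⁻¹' {fun _ => 2}) := fun i =>
    (measurable_adding.iterate i) (measurableSet_singleton _)
  have h2 : haar (⋃ i, adding^[i] ⁻¹' {fun _ => 2}) = 0 := by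
    rw [measure_iUnion_null_iff]
    intro i
    rw [(measurePreserving_adding.iterate i).measure_preimage
      (measurableSet_singleton _).nullMeasurableSet, haar_singleton]
  have h3 := h.measure_coords n (MeasurableSet.iUnion h1)
  rw [h2, mul_zero] at h3
  filter_upwards [measure_eq_zero_iff_ae_notMem.1 h3] with y hy hyE i hi
  exact hy ⟨hyE, Set.mem_iUnion.2 ⟨i, hi⟩⟩

/-- Over the time `m * height n`, a level of Tower `n` that stays away from the ends of the tower
comes back `φ^(m)` levels below, and `φ^(m)` is independent of the level. -/
theorem measureReal_lev_inter_lev [IsFiniteMeasure μ] (h : IsTowers T μ E) (m n : ℕ) {a l : ℤ}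
    (ha : m ≤ a) (ha' : a < height n) (hl : 0 ≤ l) (hl' : l < height n) :
    μ.real (lev T E n l ∩ lev T E n (a + m * height n)) =
      ∑ s ∈ Finset.range (m + 1), dist m s * μ.real (lev T E n l ∩ lev T E n (a - s)) := by
  have hsum : ∀ s ≤ m, l ≠ a - s → μ.real (lev T E n l ∩ lev T E n (a - s)) = 0 := by
    intro s hs hne
    rw [(h.disjoint_lev hl hl' (by omega) (by omega) hne).inter_eq]
    simp
  have hpre : μ.real (lev T E n l ∩ lev T E n (a + m * height n)) =
      μ.real (E n ∩ {y | a - phiSum m (coords T E n y) = l}) := by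
    rw [measureReal_def, measureReal_def,
      ← (measurePreserving_tpow h.measurePreserving (a + m * height n)).measure_preimage
        ((h.measurableSet_lev _ _).inter (h.measurableSet_lev _ _)).nullMeasurableSet]
    congr 1
    refine measure_congr ?_
    filter_upwards [h.ae_coords_ne n] with y hy
    refine propext ?_
    change (tpow T (a + m * height n) y ∈ lev T E n l ∧
      tpow T (a + m * height n) y ∈ lev T E n (a + m * height n)) ↔ y ∈ E n ∧ _ = l
    rw [tpow_mem_lev T E n (a + m * height n), sub_self, lev_zero, and_comm]
    refine and_congr_right fun hyE => ?_
    have h1 := (h.iterated_return hyE (hy hyE) m).1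
    have h2 := phiSum_le m (coords T E n y)
    set s := phiSum m (coords T E n y)
    have h3 : tpow T (a + m * height n) y ∈ lev T E n (a - s) := by
      rw [← lev_zero T E n] at h1
      rw [tpow_mem_lev] at h1 ⊢
      rwa [show a - s - (a + m * height n) = 0 - (m * height n + s : ℤ) by ring]
    constructor
    · intro h4
      by_contra hne
      exact Set.disjoint_left.1
        (h.disjoint_lev (by omega) (by omega) hl hl' hne) h3 h4
    · intro h4; rwa [← h4]
  rw [hpre]
  by_cases hs : ∃ s ∈ Finset.range (m + 1), l = a - s
  · obtain ⟨s, hs, rfl⟩ := hs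
    rw [Finset.sum_eq_single s]
    · have : {y | a - phiSum m (coords T E n y) = a - s} =
          coords T E n ⁻¹' {x | phiSum m x = s} := by
        ext y; simp
      have hms : MeasurableSet {x | phiSum m x = s} :=
        measurable_phiSum m (measurableSet_singleton s)
      rw [this, measureReal_def, h.measure_coords n hms,
        ENNReal.toReal_mul, Set.inter_self, measureReal_def, h.measure_lev, mul_comm]
      rfl
    · intro s' hs' hne
      rw [hsum s' (by simpa [Nat.lt_succ_iff] using hs') (by omega), mul_zero]
    · intro h; exact absurd hs h
  · push Not at hs
    rw [Finset.sum_eq_zero fun s hs' => by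
      rw [hsum s (by simpa [Nat.lt_succ_iff] using hs') (hs s hs'), mul_zero]]
    have : {y | a - phiSum m (coords T E n y) = l} = ∅ := by
      refine Set.eq_empty_of_forall_notMem fun y hy => ?_
      exact hs (phiSum m (coords T E n y))
        (Finset.mem_range.2 (Nat.lt_succ_of_le (phiSum_le m _))) (Eq.symm hy)
    simp [this]

end IsTowers

end Towers

/-! ### The Koopman operator -/

section Koopman

variable {X : Type*} [MeasurableSpace X] {μ : Measure X} {T : X ≃ᵐ X}

theorem koopmanPow_zero (hT : MeasurePreserving T μ μ) (f : Lp ℂ 2 μ) : koopmanPow T hT 0 f = f := by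
  simp [koopmanPow]

theorem koopmanPow_add (hT : MeasurePreserving T μ μ) (a b : ℤ) (f : Lp ℂ 2 μ) :
    koopmanPow T hT (a + b) f = koopmanPow T hT a (koopmanPow T hT b f) := by
  simp [koopmanPow, zpow_add]

theorem koopmanPow_one_apply (hT : MeasurePreserving T μ μ) (f : Lp ℂ 2 μ) :
    koopmanPow T hT 1 f = Lp.compMeasurePreserving T hT f := by
  simp [koopmanPow]; rfl

theorem norm_koopmanPow_apply (hT : MeasurePreserving T μ μ) (a : ℤ) (f : Lp ℂ 2 μ) :
    ‖koopmanPow T hT a f‖ = ‖f‖ := (koopman T hT ^ a).norm_map f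

theorem norm_koopmanPow_le (hT : MeasurePreserving T μ μ) (a : ℤ) : ‖koopmanPow T hT a‖ ≤ 1 :=
  ContinuousLinearMap.opNorm_le_bound _ zero_le_one fun f => by rw [norm_koopmanPow_apply, one_mul]

theorem koopmanPow_one_pow (hT : MeasurePreserving T μ μ) (s : ℕ) :
    koopmanPow T hT 1 ^ s = koopmanPow T hT s := by
  induction s with
  | zero => ext1 f; simp [koopmanPow_zero]
  | succ s ih =>
    ext1 f
    rw [pow_succ, ih, Nat.cast_succ, koopmanPow_add]; rfl

theorem koopmanPow_one_mem_unitary (hT : MeasurePreserving T μ μ) :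
    koopmanPow T hT 1 ∈ unitary (Lp ℂ 2 μ →L[ℂ] Lp ℂ 2 μ) := by
  have h : star (koopmanPow T hT 1) = koopmanPow T hT (-1) := by
    rw [ContinuousLinearMap.star_eq_adjoint, koopmanPow, LinearIsometryEquiv.adjoint_eq_symm]
    simp only [koopmanPow, zpow_neg]
    rfl
  rw [Unitary.mem_iff, h]
  have h1 : ∀ f, koopmanPow T hT (-1) (koopmanPow T hT 1 f) = f := fun f => by
    rw [← koopmanPow_add, neg_add_cancel, koopmanPow_zero]
  have h2 : ∀ f, koopmanPow T hT 1 (koopmanPow T hT (-1) f) = f := fun f => by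
    rw [← koopmanPow_add, add_neg_cancel, koopmanPow_zero]
  exact ⟨ContinuousLinearMap.ext h1, ContinuousLinearMap.ext h2⟩

theorem aeval_P_apply (hT : MeasurePreserving T μ μ) (m : ℕ) (f : Lp ℂ 2 μ) :
    aeval (koopmanPow T hT 1) (P m) f =
      ∑ s ∈ Finset.range (m + 1), (dist m s : ℂ) • koopmanPow T hT s f := by
  simp only [P, map_sum, map_mul, aeval_C, map_pow, aeval_X, koopmanPow_one_pow,
    sum_apply]
  refine Finset.sum_congr rfl fun s _ => ?_
  rw [mul_apply_eq_comp, ContinuousLinearMap.algebraMap_apply]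

theorem norm_aeval_P_le (hT : MeasurePreserving T μ μ) (m : ℕ) :
    ‖aeval (koopmanPow T hT 1) (P m)‖ ≤ 1 :=
  norm_aeval_le_of_unitary (koopmanPow_one_mem_unitary hT) _ zero_le_one
    fun _ => norm_eval_P_le m

theorem koopmanPow_const [IsFiniteMeasure μ] (hT : MeasurePreserving T μ μ) (a : ℤ) :
    koopmanPow T hT a (Lp.const 2 μ (1 : ℂ)) = Lp.const 2 μ (1 : ℂ) := by
  have h1 : koopmanPow T hT 1 (Lp.const 2 μ (1 : ℂ)) = Lp.const 2 μ (1 : ℂ) := by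
    rw [koopmanPow_one_apply, ← indicatorConstLp_univ, Lp.indicatorConstLp_compMeasurePreserving]
    simp
  induction a with
  | zero => exact koopmanPow_zero hT _
  | succ a ih => rw [koopmanPow_add, h1, ih]
  | pred a ih =>
    conv_lhs => rw [← h1]
    rw [← koopmanPow_add, sub_add_cancel, ih]

end Koopman

/-! ### Indicators of the levels -/

namespace IsTowers

variable {X : Type*} [MeasurableSpace X] {μ : Measure X} [IsProbabilityMeasure μ] {T : X ≃ᵐ X}
  {E : ℕ → Set X}

/-- The indicator of `T ^ i (E n)`, as a vector of `L²`. -/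
noncomputable def ev (h : IsTowers T μ E) (n : ℕ) (i : ℤ) : Lp ℂ 2 μ :=
  indicatorConstLp 2 (h.measurableSet_lev n i) (measure_ne_top μ _) (1 : ℂ)

/-- The sum of the indicators of the sets `T ^ i (E n)`, `i ∈ J`. -/
noncomputable def vec (h : IsTowers T μ E) (n : ℕ) (J : Finset ℤ) : Lp ℂ 2 μ := ∑ i ∈ J, h.ev n i

/-- The indices of the levels of Tower `n`. -/
noncomputable def levels (n : ℕ) : Finset ℤ := Finset.Ico 0 (height n)

theorem card_levels (n : ℕ) : (levels n).card = height n := by simp [levels]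

theorem koopmanPow_ev (h : IsTowers T μ E) (n : ℕ) (i a : ℤ) :
    koopmanPow T h.measurePreserving a (h.ev n i) = h.ev n (i - a) := by
  have h1 : ∀ i, koopmanPow T h.measurePreserving 1 (h.ev n i) = h.ev n (i - 1) := by
    intro i
    rw [koopmanPow_one_apply, ev, Lp.indicatorConstLp_compMeasurePreserving, ev]
    have : T ⁻¹' lev T E n i = lev T E n (i - 1) := by
      ext x
      rw [← tpow_mem_lev]
      have := tpow_natCast T 1 x
      rw [Nat.cast_one] at this
      rw [this]; rfl
    congr 1
  induction a generalizing i with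
  | zero => rw [koopmanPow_zero, sub_zero]
  | succ a ih => rw [koopmanPow_add, h1, ih]; congr 1; ring
  | pred a ih =>
    have h2 := h1 (i + 1)
    rw [add_sub_cancel_right] at h2
    rw [← h2, ← koopmanPow_add, sub_add_cancel, ih]; congr 1; ring

theorem inner_ev_ev (h : IsTowers T μ E) (n : ℕ) (i j : ℤ) :
    inner ℂ (h.ev n i) (h.ev n j) = (μ.real (lev T E n i ∩ lev T E n j) : ℂ) :=
  L2.inner_indicatorConstLp_one_indicatorConstLp_one _ _ _ _

theorem inner_ev_ev_of_mem (h : IsTowers T μ E) {n : ℕ} {i j : ℤ} (hi : i ∈ levels n)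
    (hj : j ∈ levels n) :
    inner ℂ (h.ev n i) (h.ev n j) = if i = j then (μ.real (E n) : ℂ) else 0 := by
  rw [inner_ev_ev]
  simp only [levels, Finset.mem_Ico] at hi hj
  split_ifs with hij
  · rw [hij, Set.inter_self, measureReal_def, h.measure_lev, measureReal_def]
  · rw [(h.disjoint_lev hi.1 hi.2 hj.1 hj.2 hij).inter_eq]; simp

theorem inner_vec_vec (h : IsTowers T μ E) {n : ℕ} {I J : Finset ℤ} (hI : I ⊆ J)
    (hJ : J ⊆ levels n) : inner ℂ (h.vec n I) (h.vec n J) = (I.card * μ.real (E n) : ℂ) := by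
  simp only [vec, sum_inner, inner_sum]
  rw [Finset.sum_comm, ← nsmul_eq_mul, ← Finset.sum_const]
  refine Finset.sum_congr rfl fun i hi => ?_
  rw [Finset.sum_congr rfl fun j hj =>
    h.inner_ev_ev_of_mem (hJ (hI hi)) (hJ hj), Finset.sum_ite_eq, if_pos (hI hi)]

theorem norm_sq_vec (h : IsTowers T μ E) {n : ℕ} {J : Finset ℤ} (hJ : J ⊆ levels n) :
    ‖h.vec n J‖ ^ 2 = J.card * μ.real (E n) := by
  have h1 := h.inner_vec_vec (Finset.Subset.refl J) hJ
  rw [inner_self_eq_norm_sq_to_K] at h1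
  exact Complex.ofReal_injective (by push_cast; exact h1)

theorem inner_vec_const (h : IsTowers T μ E) (n : ℕ) (J : Finset ℤ) :
    inner ℂ (h.vec n J) (Lp.const 2 μ (1 : ℂ)) = (J.card * μ.real (E n) : ℂ) := by
  simp only [vec, sum_inner]
  rw [Finset.sum_congr rfl fun i _ => ?_, Finset.sum_const, nsmul_eq_mul]
  rw [ev, ← indicatorConstLp_univ,
    L2.inner_indicatorConstLp_one_indicatorConstLp_one _ _ _ _, Set.inter_univ, measureReal_def,
    h.measure_lev, measureReal_def]
  rfl

theorem norm_const : ‖(Lp.const 2 μ (1 : ℂ) : Lp ℂ 2 μ)‖ = 1 := by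
  rw [← indicatorConstLp_univ, norm_indicatorConstLp (by simp) (by simp)]; simp

theorem norm_sq_const_sub_vec (h : IsTowers T μ E) {n : ℕ} {J : Finset ℤ} (hJ : J ⊆ levels n) :
    ‖Lp.const 2 μ (1 : ℂ) - h.vec n J‖ ^ 2 = 1 - J.card * μ.real (E n) := by
  rw [@norm_sub_sq ℂ, norm_const, h.norm_sq_vec hJ, ← inner_conj_symm, h.inner_vec_const]
  have : (starRingEnd ℂ) (J.card * μ.real (E n) : ℂ) = ((J.card * μ.real (E n) : ℝ) : ℂ) := by
    simp
  rw [this]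
  simp only [RCLike.re_to_complex, Complex.ofReal_re]
  ring

theorem height_mul_measure_le (h : IsTowers T μ E) (n : ℕ) : height n * μ.real (E n) ≤ 1 := by
  have := h.norm_sq_const_sub_vec (Finset.Subset.refl (levels n))
  rw [card_levels] at this
  nlinarith [sq_nonneg ‖Lp.const 2 μ (1 : ℂ) - h.vec n (levels n)‖]

theorem norm_vec_le_one (h : IsTowers T μ E) {n : ℕ} {J : Finset ℤ} (hJ : J ⊆ levels n) :
    ‖h.vec n J‖ ≤ 1 := by
  have h1 : (J.card : ℝ) ≤ height n := by
    rw [← card_levels n]; exact_mod_cast Finset.card_le_card hJ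
  have h2 := h.height_mul_measure_le n
  have h3 : (J.card : ℝ) * μ.real (E n) ≤ height n * μ.real (E n) :=
    mul_le_mul_of_nonneg_right h1 measureReal_nonneg
  rw [← h.norm_sq_vec hJ] at h3
  exact (sq_le_one_iff₀ (norm_nonneg _)).1 (h3.trans h2)

theorem norm_vec_le_sqrt (h : IsTowers T μ E) {n : ℕ} {J : Finset ℤ} (hJ : J ⊆ levels n) {K : ℝ}
    (hK : J.card ≤ K) : ‖h.vec n J‖ ≤ √(K / height n) := by
  refine Real.le_sqrt_of_sq_le ?_
  have h0 : (0 : ℝ) < height n := by exact_mod_cast height_pos n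
  rw [h.norm_sq_vec hJ, le_div_iff₀ h0, mul_assoc, mul_comm (μ.real _)]
  exact (mul_le_of_le_one_right (Nat.cast_nonneg _) (h.height_mul_measure_le n)).trans hK

theorem vec_union (h : IsTowers T μ E) (n : ℕ) {I J : Finset ℤ} (hIJ : Disjoint I J) :
    h.vec n (I ∪ J) = h.vec n I + h.vec n J := Finset.sum_union hIJ

/-- Every level of Tower `n` is the union of three levels of Tower `n + 1`. -/
theorem ev_eq_sum (h : IsTowers T μ E) {n : ℕ} {i : ℤ} (hi : i ∈ levels n) :
    h.ev n i = ∑ d : Fin 3, h.ev (n + 1) (i + offset n d) := by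
  simp only [levels, Finset.mem_Ico] at hi
  have hU : lev T E n i = (lev T E (n + 1) (i + offset n 0) ∪ lev T E (n + 1) (i + offset n 1)) ∪
      lev T E (n + 1) (i + offset n 2) := by
    ext x
    have h1 : x ∈ lev T E n i ↔ tpow T (-i) x ∈ E n := Iff.rfl
    rw [h1, h.mem_base_iff]
    simp only [tpow_mem_lev, sub_neg_eq_add, Set.mem_union, add_comm i]
    constructor
    · rintro ⟨d, hd⟩
      rcases fin_three_cases d with rfl | rfl | rfl <;> simp [hd]
    · rintro ((hd | hd) | hd) <;> exact ⟨_, hd⟩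
  have hd : ∀ d e, d ≠ e → Disjoint (lev T E (n + 1) (i + offset n d))
      (lev T E (n + 1) (i + offset n e)) := fun d e hde =>
    h.disjoint_lev_offset n hi.1 hi.2 hi.1 hi.2 (Or.inr hde)
  have hm := h.measurableSet_lev (n + 1)
  rw [Fin.sum_univ_three]
  simp only [ev]
  rw [← indicatorConstLp_disjoint_union (hm _) (hm _) (measure_ne_top _ _) (measure_ne_top _ _)
      (hd 0 1 (by decide)),
    ← indicatorConstLp_disjoint_union ((hm _).union (hm _)) (hm _) (measure_ne_top _ _)
      (measure_ne_top _ _) (Set.disjoint_union_left.2 ⟨hd 0 2 (by decide), hd 1 2 (by decide)⟩)]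
  congr 1

theorem exists_vec_eq_succ (h : IsTowers T μ E) {n : ℕ} {J : Finset ℤ} (hJ : J ⊆ levels n) :
    ∃ J' ⊆ levels (n + 1), h.vec n J = h.vec (n + 1) J' := by
  have hh : height (n + 1) = 3 * height n + 1 := rfl
  refine ⟨(J ×ˢ Finset.univ).image fun p : ℤ × Fin 3 => p.1 + offset n p.2, ?_, ?_⟩
  · intro x hx
    obtain ⟨⟨i, d⟩, hp, rfl⟩ := Finset.mem_image.1 hx
    have hi := hJ (Finset.mem_product.1 hp).1
    simp only [levels, Finset.mem_Ico] at hi ⊢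
    rcases fin_three_cases d with rfl | rfl | rfl <;> simp [offset] <;> omega
  · rw [vec, vec, Finset.sum_image, Finset.sum_product]
    · exact Finset.sum_congr rfl fun i hi => h.ev_eq_sum (hJ hi)
    · rintro ⟨i, d⟩ hp ⟨j, e⟩ hq heq
      have hi := hJ (Finset.mem_product.1 hp).1
      have hj := hJ (Finset.mem_product.1 hq).1
      simp only [levels, Finset.mem_Ico] at hi hj
      rcases fin_three_cases d with rfl | rfl | rfl <;>
        rcases fin_three_cases e with rfl | rfl | rfl <;> simp [offset] at heq ⊢ <;> omega

/-- A union of levels of Tower `n` is a union of levels of every later tower. -/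
theorem exists_vec_eq (h : IsTowers T μ E) {n N : ℕ} (hN : n ≤ N) {J : Finset ℤ}
    (hJ : J ⊆ levels n) : ∃ J' ⊆ levels N, h.vec n J = h.vec N J' := by
  induction N, hN using Nat.le_induction with
  | base => exact ⟨J, hJ, rfl⟩
  | succ N _ ih =>
    obtain ⟨J', hJ', e⟩ := ih
    obtain ⟨J'', hJ'', e'⟩ := h.exists_vec_eq_succ hJ'
    exact ⟨J'', hJ'', e.trans e'⟩

/-- The indicators of the unions of levels. -/
def levelVecs (h : IsTowers T μ E) : Set (Lp ℂ 2 μ) := {f | ∃ n, ∃ J ⊆ levels n, f = h.vec n J}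

theorem indicatorConstLp_iUnion_levels (h : IsTowers T μ E) (n : ℕ) (s : Finset ℕ)
    (hs : s ⊆ Finset.range (height n)) :
    ∃ hm : MeasurableSet (⋃ i ∈ s, T^[i] '' E n),
      indicatorConstLp 2 hm (measure_ne_top μ _) (1 : ℂ) =
        h.vec n (s.map Nat.castEmbedding) := by
  have hlev : ∀ i : ℕ, MeasurableSet (T^[i] '' E n) := fun i => by
    rw [← lev_natCast]; exact h.measurableSet_lev _ _
  refine ⟨Finset.measurableSet_biUnion _ fun i _ => hlev i, ?_⟩
  induction s using Finset.induction_on with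
  | empty => simp [vec]
  | insert i s hi ih =>
    have hsub : s ⊆ Finset.range (height n) := (Finset.subset_insert _ _).trans hs
    have hdisj : Disjoint (T^[i] '' E n) (⋃ j ∈ s, T^[j] '' E n) := by
      simp only [Set.disjoint_iUnion_right]
      intro j hj
      exact h.disjoint_image n i (Finset.mem_range.1 (hs (Finset.mem_insert_self _ _))) j
        (Finset.mem_range.1 (hsub hj)) (by rintro rfl; exact hi hj)
    have hu : ⋃ j ∈ insert i s, T^[j] '' E n = T^[i] '' E n ∪ ⋃ j ∈ s, T^[j] '' E n := by
      simp
    have e1 := ih hsub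
    have e2 := indicatorConstLp_disjoint_union (p := 2) (hlev i)
      (Finset.measurableSet_biUnion s fun i _ => hlev i) (measure_ne_top μ _)
      (measure_ne_top μ _) hdisj (1 : ℂ)
    rw [e1] at e2
    have e3 : indicatorConstLp 2 (hlev i) (measure_ne_top μ _) (1 : ℂ) = h.ev n i := by
      simp only [ev, lev_natCast]
    rw [e3] at e2
    simp only [vec, Finset.sum_map, Nat.castEmbedding_apply] at e2 ⊢
    rw [Finset.sum_insert hi, ← e2]
    simp only [hu]

theorem map_cast_subset_levels {n : ℕ} {s : Finset ℕ} (hs : s ⊆ Finset.range (height n)) :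
    s.map (Nat.castEmbedding (R := ℤ)) ⊆ levels n := by
  intro x hx
  obtain ⟨i, hi, rfl⟩ := Finset.mem_map.1 hx
  have := Finset.mem_range.1 (hs hi)
  simp [levels, this]

/-- The indicators of the unions of levels are total in `L²`. -/
theorem topologicalClosure_span_levelVecs (h : IsTowers T μ E) :
    (Submodule.span ℂ h.levelVecs).topologicalClosure = ⊤ := by
  have hind : ∀ (A : Set X) (hA : MeasurableSet A),
      indicatorConstLp 2 hA (measure_ne_top μ A) (1 : ℂ) ∈
        (Submodule.span ℂ h.levelVecs).topologicalClosure := by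
    intro A hA
    have hdense : μ.MeasureDense
        {B | ∃ n, ∃ s ⊆ Finset.range (height n), B = ⋃ i ∈ s, T^[i] '' E n} := by
      refine ⟨?_, fun A hA _ ε hε => ?_⟩
      · rintro B ⟨n, s, hs, rfl⟩
        exact (h.indicatorConstLp_iUnion_levels n s hs).1
      · obtain ⟨n, s, hs, hμ⟩ := h.exhaust A hA (ENNReal.ofReal ε) (by simpa using hε)
        exact ⟨_, ⟨n, s, hs, rfl⟩, hμ⟩
    have : Fact ((2 : ENNReal) ≠ ⊤) := ⟨by simp⟩
    have := hdense.indicatorConstLp_subset_closure 2 (1 : ℂ) ⟨A, hA, measure_ne_top μ A, rfl⟩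
    refine closure_mono ?_ this
    rintro _ ⟨B, ⟨n, s, hs, rfl⟩, hμ, rfl⟩
    obtain ⟨hm, e⟩ := h.indicatorConstLp_iUnion_levels n s hs
    exact Submodule.subset_span ⟨n, _, map_cast_subset_levels hs, e⟩
  rw [eq_top_iff]
  rintro f -
  induction f using Lp.induction (by simp : (2 : ENNReal) ≠ ⊤) with
  | indicatorConst c hs hμs =>
    have h1 := (Submodule.span ℂ h.levelVecs).topologicalClosure.smul_mem c (hind _ hs)
    have h2 : c • indicatorConstLp 2 hs (measure_ne_top μ _) (1 : ℂ) =
        indicatorConstLp 2 hs (measure_ne_top μ _) c := by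
      simp only [indicatorConstLp, ← MemLp.toLp_const_smul]
      congr 1
      funext x
      simp [Set.indicator]
    rw [h2] at h1
    exact h1
  | add hf hg _ ihf ihg => exact Submodule.add_mem _ ihf ihg
  | isClosed => exact Submodule.isClosed_topologicalClosure _

end IsTowers

/-! ### Correlations of levels -/

namespace IsTowers

variable {X : Type*} [MeasurableSpace X] {μ : Measure X} [IsProbabilityMeasure μ] {T : X ≃ᵐ X}
  {E : ℕ → Set X}

/-- The functions that are constant on each level of Tower `n` and vanish outside of it. -/
noncomputable def levelSpan (h : IsTowers T μ E) (n : ℕ) : Submodule ℂ (Lp ℂ 2 μ) :=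
  Submodule.span ℂ (h.ev n '' levels n)

theorem vec_mem_levelSpan (h : IsTowers T μ E) {n : ℕ} {J : Finset ℤ} (hJ : J ⊆ levels n) :
    h.vec n J ∈ h.levelSpan n :=
  Submodule.sum_mem _ fun i hi => Submodule.subset_span ⟨i, hJ hi, rfl⟩

/-- On the levels of Tower `n` that `T ^ q` moves to levels at distance at least `m` from the bottom
of the tower, `T̂ ^ (-(q + m * height n))` and `P m T̂ * T̂ ^ (-q)` have the same coefficients. -/
theorem inner_koopmanPow_vec (h : IsTowers T μ E) {n m : ℕ} {q : ℤ} {I : Finset ℤ}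
    (hI : ∀ i ∈ I, m ≤ i + q ∧ i + q < height n) {g : Lp ℂ 2 μ} (hg : g ∈ h.levelSpan n) :
    inner ℂ g (koopmanPow T h.measurePreserving (-(q + m * height n)) (h.vec n I)) =
      inner ℂ g (aeval (koopmanPow T h.measurePreserving 1) (P m)
        (koopmanPow T h.measurePreserving (-q) (h.vec n I))) := by
  induction hg using Submodule.span_induction with
  | zero => simp
  | add f g _ _ hf hg => rw [inner_add_left, inner_add_left, hf, hg]
  | smul c f _ hf => rw [inner_smul_left, inner_smul_left, hf]
  | mem g hg =>
    obtain ⟨l, hl, rfl⟩ := hg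
    have hl' : 0 ≤ l ∧ l < height n := by simpa [levels] using hl
    simp only [vec, map_sum, inner_sum]
    refine Finset.sum_congr rfl fun i hi => ?_
    have hi' := hI i hi
    rw [koopmanPow_ev, koopmanPow_ev, aeval_P_apply, inner_sum, inner_ev_ev,
      show i - -(q + m * height n : ℤ) = (i + q) + m * height n by ring,
      h.measureReal_lev_inter_lev m n hi'.1 hi'.2 hl'.1 hl'.2]
    push_cast
    refine Finset.sum_congr rfl fun s _ => ?_
    rw [inner_smul_right, koopmanPow_ev, inner_ev_ev, sub_neg_eq_add]

/-- If `q` is small with respect to `height n`, only the levels near the ends of the tower contribute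
to the difference between `T̂ ^ (-(q + m * height n))` and `P m T̂ * T̂ ^ (-q)`. -/
theorem norm_inner_koopmanPow_sub_le (h : IsTowers T μ E) {n m : ℕ} {q : ℤ} {J : Finset ℤ}
    (hJ : J ⊆ levels n) {g : Lp ℂ 2 μ} (hg : g ∈ h.levelSpan n) :
    ‖inner ℂ g ((koopmanPow T h.measurePreserving (-(q + m * height n)) -
      aeval (koopmanPow T h.measurePreserving 1) (P m) *
        koopmanPow T h.measurePreserving (-q)) (h.vec n J))‖ ≤
      ‖g‖ * (2 * √((m + |(q : ℝ)|) / height n)) := by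
  set A := koopmanPow T h.measurePreserving (-(q + m * height n)) -
      aeval (koopmanPow T h.measurePreserving 1) (P m) * koopmanPow T h.measurePreserving (-q)
  have hA : ‖A‖ ≤ 2 := by
    refine (norm_sub_le _ _).trans ?_
    have h1 := norm_koopmanPow_le h.measurePreserving (-(q + m * height n))
    have h2 := (norm_mul_le (aeval (koopmanPow T h.measurePreserving 1) (P m))
      (koopmanPow T h.measurePreserving (-q))).trans
      (mul_le_one₀ (norm_aeval_P_le h.measurePreserving m) (norm_nonneg _)
        (norm_koopmanPow_le h.measurePreserving (-q)))
    linarith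
  set I := J.filter fun i => m ≤ i + q ∧ i + q < height n
  set R := J.filter fun i => ¬ (m ≤ i + q ∧ i + q < height n)
  have hsplit : h.vec n J = h.vec n I + h.vec n R := by
    rw [← h.vec_union n (Finset.disjoint_filter_filter_not _ _ _), Finset.filter_union_filter_not_eq]
  have h0 : inner ℂ g (A (h.vec n I)) = 0 := by
    have := h.inner_koopmanPow_vec (n := n) (m := m) (q := q) (I := I)
      (fun i hi => (Finset.mem_filter.1 hi).2) hg
    rw [sub_apply, inner_sub_right, this]
    exact sub_self _
  have hcard : (R.card : ℝ) ≤ m + |(q : ℝ)| := by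
    have h1 : R ⊆ Finset.Ico 0 (m - q) ∪ Finset.Ico (height n - q) (height n) := by
      intro i hi
      obtain ⟨hiJ, hi'⟩ := Finset.mem_filter.1 hi
      have := hJ hiJ
      simp only [levels, Finset.mem_Ico, Finset.mem_union] at this ⊢
      omega
    have h2 := (Finset.card_le_card h1).trans (Finset.card_union_le _ _)
    rw [Int.card_Ico, Int.card_Ico] at h2
    have h3 : (R.card : ℤ) ≤ m + |q| := by
      rcases abs_cases q with h | h <;> omega
    exact_mod_cast h3
  rw [hsplit, map_add, inner_add_right, h0, zero_add]
  refine (norm_inner_le_norm _ _).trans (mul_le_mul_of_nonneg_left ?_ (norm_nonneg _))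
  exact (A.le_of_opNorm_le hA _).trans (mul_le_mul_of_nonneg_left
    (h.norm_vec_le_sqrt ((Finset.filter_subset _ _).trans hJ) hcard) zero_le_two)

/-- For `0 ≤ q ≤ height n + c`, Tower `n` splits into the levels that `T ^ q` keeps inside of the
tower, for which `P m` is relevant, the levels that it takes through the top, for which `P (m + 1)`
is, and a bounded number of exceptions. -/
theorem norm_inner_koopmanPow_le (h : IsTowers T μ E) {n m c : ℕ} {q : ℤ} (hq : 0 ≤ q)
    (hqc : q ≤ height n + c) {J : Finset ℤ} (hJ : J ⊆ levels n) {g : Lp ℂ 2 μ}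
    (hg : g ∈ h.levelSpan n) :
    ‖inner ℂ g (koopmanPow T h.measurePreserving (-(q + m * height n)) (h.vec n J))‖ ≤
      ‖(aeval (koopmanPow T h.measurePreserving 1) (P m)).adjoint g‖ +
      ‖(aeval (koopmanPow T h.measurePreserving 1) (P (m + 1))).adjoint g‖ +
      ‖g‖ * √((2 * m + 1 + c) / height n) := by
  have hbound : ∀ (m : ℕ) (a : ℤ) (I : Finset ℤ), I ⊆ J →
      ‖inner ℂ g (aeval (koopmanPow T h.measurePreserving 1) (P m)
        (koopmanPow T h.measurePreserving a (h.vec n I)))‖ ≤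
      ‖(aeval (koopmanPow T h.measurePreserving 1) (P m)).adjoint g‖ := by
    intro m a I hIJ
    rw [← ContinuousLinearMap.adjoint_inner_left]
    refine (norm_inner_le_norm _ _).trans (mul_le_of_le_one_right (norm_nonneg _) ?_)
    rw [norm_koopmanPow_apply]
    exact h.norm_vec_le_one (hIJ.trans hJ)
  set I := J.filter fun i => m ≤ i + q ∧ i + q < height n
  set R := J.filter fun i => ¬ (m ≤ i + q ∧ i + q < height n)
  set I' := R.filter fun i => (m + 1 : ℕ) ≤ i + (q - height n) ∧ i + (q - height n) < height n
  set R' := R.filter fun i => ¬ ((m + 1 : ℕ) ≤ i + (q - height n) ∧ i + (q - height n) < height n)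
  have hRJ : R ⊆ J := Finset.filter_subset _ _
  have hsplit : h.vec n J = h.vec n I + (h.vec n I' + h.vec n R') := by
    rw [← h.vec_union n (Finset.disjoint_filter_filter_not _ _ _),
      Finset.filter_union_filter_not_eq, ← h.vec_union n (Finset.disjoint_filter_filter_not _ _ _),
      Finset.filter_union_filter_not_eq]
  have h1 := h.inner_koopmanPow_vec (n := n) (m := m) (q := q) (I := I)
      (fun i hi => (Finset.mem_filter.1 hi).2) hg
  have h2 := h.inner_koopmanPow_vec (n := n) (m := m + 1) (q := q - height n) (I := I')
      (fun i hi => (Finset.mem_filter.1 hi).2) hg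
  rw [show q - height n + (m + 1 : ℕ) * height n = (q + m * height n : ℤ) by push_cast; ring] at h2
  have hcard : (R'.card : ℝ) ≤ 2 * m + 1 + c := by
    have h1 : R' ⊆ Finset.Ico (-q) (m - q) ∪ (Finset.Ico (height n - q) (height n + m + 1 - q) ∪
        Finset.Ico (2 * height n - q) (2 * height n - q + c)) := by
      intro i hi
      obtain ⟨hiR, hi'⟩ := Finset.mem_filter.1 hi
      obtain ⟨hiJ, hi''⟩ := Finset.mem_filter.1 hiR
      have := hJ hiJ
      simp only [levels, Finset.mem_Ico, Finset.mem_union] at this ⊢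
      omega
    have h2 := (Finset.card_le_card h1).trans ((Finset.card_union_le _ _).trans
      (Nat.add_le_add_left (Finset.card_union_le _ _) _))
    rw [Int.card_Ico, Int.card_Ico, Int.card_Ico] at h2
    have h3 : R'.card ≤ 2 * m + 1 + c := by omega
    exact_mod_cast h3
  rw [hsplit, map_add, map_add, inner_add_right, inner_add_right, h1, h2, ← add_assoc]
  refine (norm_add₃_le).trans (add_le_add (add_le_add (hbound _ _ _ (Finset.filter_subset _ _))
    (hbound _ _ _ ((Finset.filter_subset _ _).trans hRJ))) ?_)
  refine (norm_inner_le_norm _ _).trans (mul_le_mul_of_nonneg_left ?_ (norm_nonneg _))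
  rw [norm_koopmanPow_apply]
  exact h.norm_vec_le_sqrt (((Finset.filter_subset _ _).trans hRJ).trans hJ) hcard

/-! ### Ergodicity -/

/-- The towers fill the space. -/
theorem exists_norm_const_sub_vec_lt (h : IsTowers T μ E) {ε : ℝ} (hε : 0 < ε) (n₀ : ℕ) :
    ∃ n ≥ n₀, ‖Lp.const 2 μ (1 : ℂ) - h.vec n (levels n)‖ < ε := by
  have h1 : Tendsto (fun n => ‖Lp.const 2 μ (1 : ℂ) - h.vec n (levels n)‖ ^ 2) atTop (𝓝 0) := by
    rw [NormedAddGroup.tendsto_nhds_zero]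
    intro δ hδ
    obtain ⟨n, s, hs, hμ⟩ := h.exhaust Set.univ .univ (ENNReal.ofReal δ) (by simpa using hδ)
    obtain ⟨hm, e⟩ := h.indicatorConstLp_iUnion_levels n s hs
    filter_upwards [eventually_ge_atTop n] with N hN
    obtain ⟨J', hJ', e'⟩ := h.exists_vec_eq hN (map_cast_subset_levels hs)
    have h2 : ‖Lp.const 2 μ (1 : ℂ) - h.vec N J'‖ ^ 2 < δ := by
      rw [← e', ← e, ← indicatorConstLp_univ, ← dist_eq_norm, dist_indicatorConstLp_eq_norm,
        norm_indicatorConstLp (by simp) (by simp), norm_one, one_mul, ENNReal.toReal_ofNat,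
        ← Real.sqrt_eq_rpow, Real.sq_sqrt measureReal_nonneg]
      exact (ENNReal.lt_ofReal_iff_toReal_lt (measure_ne_top _ _)).1 hμ
    rw [Real.norm_of_nonneg (sq_nonneg _)]
    refine lt_of_le_of_lt ?_ h2
    rw [h.norm_sq_const_sub_vec hJ', h.norm_sq_const_sub_vec (Finset.Subset.refl _)]
    gcongr
  obtain ⟨n, hn, hn'⟩ := ((h1.eventually_lt_const (pow_pos hε 2)).and
    (eventually_ge_atTop n₀)).exists
  exact ⟨n, hn', lt_of_pow_lt_pow_left₀ 2 hε.le hn⟩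

/-- An invariant function has the same integral on all the levels of a tower. -/
theorem inner_vec_of_invariant (h : IsTowers T μ E) {f : Lp ℂ 2 μ}
    (hf : koopmanPow T h.measurePreserving 1 f = f) (n : ℕ) (J : Finset ℤ) :
    inner ℂ (h.vec n J) f = J.card * inner ℂ (h.ev n 0) f := by
  have h1 : ∀ a : ℤ, koopmanPow T h.measurePreserving a f = f := by
    intro a
    induction a with
    | zero => exact koopmanPow_zero _ _
    | succ a ih => rw [koopmanPow_add, hf, ih]
    | pred a ih =>
      conv_lhs => rw [← hf]
      rw [← koopmanPow_add, sub_add_cancel, ih]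
  have h2 : ∀ i : ℤ, inner ℂ (h.ev n i) f = inner ℂ (h.ev n 0) f := by
    intro i
    have h3 : h.ev n i = koopmanPow T h.measurePreserving (-i) (h.ev n 0) := by
      rw [koopmanPow_ev, zero_sub, neg_neg]
    rw [h3]
    conv_lhs => rw [← h1 (-i)]
    exact (koopman T h.measurePreserving ^ (-i)).inner_map_map _ _
  rw [vec, sum_inner, Finset.sum_congr rfl fun i _ => h2 i, Finset.sum_const, nsmul_eq_mul]

/-- An invariant function with integral `0` vanishes. -/
theorem eq_zero_of_invariant (h : IsTowers T μ E) {f : Lp ℂ 2 μ}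
    (hf : koopmanPow T h.measurePreserving 1 f = f)
    (hf0 : inner ℂ (Lp.const 2 μ (1 : ℂ)) f = 0) : f = 0 := by
  have hv : ∀ n, ∀ J ⊆ levels n, inner ℂ (h.vec n J) f = 0 := by
    intro n J hJ
    rw [← norm_le_zero_iff]
    refine le_of_forall_pos_le_add fun ε hε => ?_
    obtain ⟨N, hN, hN'⟩ := h.exists_norm_const_sub_vec_lt
      (show 0 < ε / (‖f‖ + 1) by positivity) n
    obtain ⟨J', hJ', e⟩ := h.exists_vec_eq hN hJ
    calc ‖inner ℂ (h.vec n J) f‖ = J'.card * ‖inner ℂ (h.ev N 0) f‖ := by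
          rw [e, h.inner_vec_of_invariant hf, norm_mul, Complex.norm_natCast]
      _ ≤ (levels N).card * ‖inner ℂ (h.ev N 0) f‖ := by
          gcongr
      _ = ‖inner ℂ (Lp.const 2 μ (1 : ℂ) - h.vec N (levels N)) f‖ := by
          rw [inner_sub_left, hf0, zero_sub, norm_neg, h.inner_vec_of_invariant hf, norm_mul,
            Complex.norm_natCast]
      _ ≤ ε / (‖f‖ + 1) * (‖f‖ + 1) := by
          refine (norm_inner_le_norm _ _).trans ?_
          gcongr; linarith
      _ = 0 + ε := by field_simp; simp
  have h1 : f ∈ (Submodule.span ℂ h.levelVecs)ᗮ := by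
    rw [Submodule.mem_orthogonal]
    intro u hu
    induction hu using Submodule.span_induction with
    | zero => simp
    | add f g _ _ hf hg => rw [inner_add_left, hf, hg, add_zero]
    | smul c f _ hf => rw [inner_smul_left, hf, mul_zero]
    | mem u hu => obtain ⟨n, J, hJ, rfl⟩ := hu; exact hv n J hJ
  have h2 := (Submodule.topologicalClosure_eq_top_iff).1 h.topologicalClosure_span_levelVecs
  rw [h2] at h1
  simpa using h1

/-- Ergodicity of Chacon's automorphism. -/
theorem mem_orthogonal_ker (h : IsTowers T μ E) {g : Lp ℂ 2 μ}
    (hg : inner ℂ g (Lp.const 2 μ (1 : ℂ)) = 0) :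
    g ∈ (1 - koopmanPow T h.measurePreserving 1).kerᗮ := by
  rw [Submodule.mem_orthogonal']
  intro f hf
  have hf' : koopmanPow T h.measurePreserving 1 f = f := by
    have : f - koopmanPow T h.measurePreserving 1 f = 0 := hf
    exact (sub_eq_zero.1 this).symm
  set e := Lp.const 2 μ (1 : ℂ)
  have he : inner ℂ e e = 1 := by rw [inner_self_eq_norm_sq_to_K, norm_const]; simp
  have h1 : f - inner ℂ e f • e = 0 := by
    refine h.eq_zero_of_invariant ?_ ?_
    · rw [map_sub, map_smul, hf', koopmanPow_const]
    · rw [inner_sub_right, inner_smul_right, he, mul_one, sub_self]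
  rw [sub_eq_zero.1 h1, inner_smul_right, hg, mul_zero]

end IsTowers

/-! ### Greedy expansions -/

/-- The constant `c_r` in `a_0 h_n + ⋯ + a_r h_(n - r) = m_r h_(n - r) + c_r`, where `m_r` is
`lead a r`. -/
def carry (a : ℕ → ℕ) : ℕ → ℕ
  | 0 => 0
  | r + 1 => carry a r + lead a r

theorem lead_congr {a b : ℕ → ℕ} {r : ℕ} (h : ∀ l ≤ r, a l = b l) : lead a r = lead b r := by
  induction r with
  | zero => exact h 0 le_rfl
  | succ r ih => rw [lead, lead, ih fun l hl => h l (by omega), h (r + 1) le_rfl]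

theorem carry_congr {a b : ℕ → ℕ} {r : ℕ} (h : ∀ l ≤ r, a l = b l) : carry a r = carry b r := by
  induction r with
  | zero => rfl
  | succ r ih =>
    rw [carry, carry, ih fun l hl => h l (by omega), lead_congr fun l hl => h l (by omega)]

theorem le_lead (a : ℕ → ℕ) (r : ℕ) : a 0 ≤ lead a r := by
  induction r with
  | zero => exact le_rfl
  | succ r ih => rw [lead]; omega

theorem lead_add_of_eq_zero {a : ℕ → ℕ} {r : ℕ} (h : ∀ l > r, a l = 0) (p : ℕ) :
    lead a (r + p) = 3 ^ p * lead a r := by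
  induction p with
  | zero => simp
  | succ p ih => rw [← add_assoc, lead, ih, h _ (by omega), pow_succ]; ring

theorem lead_add_of_eq_two {a : ℕ → ℕ} {r : ℕ} (h : ∀ l > r, a l = 2) (p : ℕ) :
    lead a (r + p) + 1 = 3 ^ p * (lead a r + 1) := by
  induction p with
  | zero => simp
  | succ p ih => rw [← add_assoc, lead, h _ (by omega), pow_succ]; linarith

theorem lt_height (n : ℕ) : n < height n := by
  induction n with
  | zero => simp [height]
  | succ n ih => rw [height]; omega

theorem height_strictMono : StrictMono height :=
  strictMono_nat_of_lt_succ fun n => by simp only [height]; omega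

theorem exists_height_add (p : ℕ) : ∃ t, ∀ n, height (n + p) = 3 ^ p * height n + t := by
  induction p with
  | zero => exact ⟨0, by simp⟩
  | succ p ih =>
    obtain ⟨t, ht⟩ := ih
    exact ⟨3 * t + 1, fun n => by rw [← add_assoc, height, ht, pow_succ]; ring⟩

theorem height_topIndex_le {k : ℕ} (hk : 0 < k) : height (topIndex k) ≤ k :=
  Nat.findGreatest_spec (P := fun n => height n ≤ k) (Nat.zero_le _) hk

theorem le_topIndex {k n : ℕ} (h : height n ≤ k) : n ≤ topIndex k :=
  Nat.le_findGreatest ((lt_height n).le.trans h) h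

theorem lt_height_topIndex_succ (k : ℕ) : k < height (topIndex k + 1) := by
  by_contra hlt
  have := le_topIndex (not_lt.1 hlt)
  omega

theorem tendsto_topIndex {k : ℕ → ℕ} (hk : Tendsto k atTop atTop) :
    Tendsto (fun j => topIndex (k j)) atTop atTop :=
  tendsto_atTop.2 fun n => (tendsto_atTop.1 hk (height n)).mono fun _ h => le_topIndex h

theorem greedyRem_succ_lt (k l : ℕ) : greedyRem k (l + 1) < height (topIndex k - l) :=
  Nat.mod_lt _ (height_pos _)

theorem eq_lead_mul_add (k : ℕ) {r : ℕ} (hr : r ≤ topIndex k) :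
    k = lead (greedyDigit k) r * height (topIndex k - r) + carry (greedyDigit k) r +
      greedyRem k (r + 1) := by
  have hstep : ∀ l ≤ topIndex k, greedyRem k l =
      greedyDigit k l * height (topIndex k - l) + greedyRem k (l + 1) := fun l hl => by
    rw [greedyDigit, if_pos hl, greedyRem, mul_comm, Nat.div_add_mod]
  induction r with
  | zero => simpa [lead, carry, greedyRem] using hstep 0 hr
  | succ r ih =>
    have h1 := ih (by omega)
    have h2 := hstep (r + 1) hr
    have h3 : height (topIndex k - r) = 3 * height (topIndex k - (r + 1)) + 1 := by
      rw [show topIndex k - r = topIndex k - (r + 1) + 1 by omega]; rfl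
    rw [h3, h2] at h1
    rw [lead, carry]
    conv_lhs => rw [h1]
    ring

/-- After a greedy digit greater than `2`, all the digits are `0`. -/
theorem greedyDigit_eq_zero {k l : ℕ} (h : 2 < greedyDigit k l) {l' : ℕ} (hl : l < l') :
    greedyDigit k l' = 0 := by
  have hlk : l ≤ topIndex k := by
    by_contra hlt; rw [greedyDigit, if_neg hlt] at h; omega
  have h1 : greedyRem k l ≤ 3 * height (topIndex k - l) := by
    rw [← Nat.lt_succ_iff]
    change _ < height (topIndex k - l + 1)
    cases l with
    | zero => exact lt_height_topIndex_succ k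
    | succ l =>
      rw [show topIndex k - (l + 1) + 1 = topIndex k - l by omega]
      exact greedyRem_succ_lt k l
  have h2 : greedyRem k (l + 1) = 0 := by
    rw [greedyDigit, if_pos hlk] at h
    have h3 : 3 * height (topIndex k - l) ≤ greedyRem k l :=
      (Nat.le_div_iff_mul_le (height_pos _)).1 h
    rw [greedyRem, le_antisymm h1 h3, Nat.mul_mod_left]
  have h3 : greedyRem k l' = 0 := by
    induction l', hl using Nat.le_induction with
    | base => exact h2
    | succ l' _ ih => rw [greedyRem, ih, Nat.zero_mod]
  simp [greedyDigit, h3]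

section Limits

variable {k : ℕ → ℕ} {α : ℕ → ℕ}

theorem eventually_greedyDigit_eq
    (hα : ∀ l, Tendsto (fun j => greedyDigit (k j) l) atTop (𝓝 (α l))) (r : ℕ) :
    ∀ᶠ j in atTop, ∀ l ≤ r, greedyDigit (k j) l = α l := by
  have : ∀ l, ∀ᶠ j in atTop, greedyDigit (k j) l = α l := fun l => by
    have := hα l
    rwa [nhds_discrete, tendsto_pure] at this
  have h2 := (Finset.eventually_all (Finset.range (r + 1))).2 fun l _ => this l
  filter_upwards [h2] with j hj l hl
  exact hj l (Finset.mem_range.2 (by omega))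

theorem eventually_eq_lead_mul_add (hk : Tendsto k atTop atTop)
    (hα : ∀ l, Tendsto (fun j => greedyDigit (k j) l) atTop (𝓝 (α l))) (r : ℕ) :
    ∀ᶠ j in atTop, r ≤ topIndex (k j) ∧
      k j = lead α r * height (topIndex (k j) - r) + carry α r + greedyRem (k j) (r + 1) := by
  filter_upwards [eventually_greedyDigit_eq hα r, tendsto_atTop.1 (tendsto_topIndex hk) r]
    with j hj hr
  refine ⟨hr, ?_⟩
  rw [← lead_congr hj, ← carry_congr hj]
  exact eq_lead_mul_add (k j) hr

theorem tendsto_height_topIndex_sub (hk : Tendsto k atTop atTop) (r : ℕ) :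
    Tendsto (fun j => (height (topIndex (k j) - r) : ℝ)) atTop atTop :=
  tendsto_natCast_atTop_atTop.comp (height_strictMono.tendsto_atTop.comp
    ((tendsto_sub_atTop_nat r).comp (tendsto_topIndex hk)))

theorem limit_digit_le_two
    (hα : ∀ l, Tendsto (fun j => greedyDigit (k j) l) atTop (𝓝 (α l)))
    (h0 : {l | α l ≠ 0}.Infinite) (l : ℕ) : α l ≤ 2 := by
  by_contra hl
  obtain ⟨l', hl', hlt⟩ := h0.exists_gt l
  obtain ⟨j, hj⟩ := (eventually_greedyDigit_eq hα l').exists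
  refine hl' ?_
  rw [← hj l' le_rfl]
  exact greedyDigit_eq_zero (by rw [hj l hlt.le]; omega) hlt

theorem one_le_limit_digit_zero (hk_pos : ∀ j, 0 < k j)
    (hα : ∀ l, Tendsto (fun j => greedyDigit (k j) l) atTop (𝓝 (α l))) : 1 ≤ α 0 := by
  obtain ⟨j, hj⟩ := (eventually_greedyDigit_eq hα 0).exists
  rw [← hj 0 le_rfl, greedyDigit, if_pos (Nat.zero_le _)]
  exact (Nat.one_le_div_iff (height_pos _)).2 (height_topIndex_le (hk_pos j))

/-- If the digits are eventually all `0` (`e = 0`) or all `2` (`e = 1`), then `k j` is close to a fixed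
multiple of `height (topIndex (k j) - r)`. -/
theorem tendsto_sub_div_height (hk : Tendsto k atTop atTop)
    (hα : ∀ l, Tendsto (fun j => greedyDigit (k j) l) atTop (𝓝 (α l))) {r M e : ℕ} (he : e ≤ 1)
    (hM : ∀ p, lead α (r + p) + e = 3 ^ p * M) :
    Tendsto (fun j => |(((k j : ℤ) - M * height (topIndex (k j) - r) : ℤ) : ℝ)| /
      height (topIndex (k j) - r)) atTop (𝓝 0) := by
  rw [NormedAddGroup.tendsto_nhds_zero]
  intro ε hε
  obtain ⟨p, hp⟩ := exists_pow_lt_of_lt_one (half_pos hε) (show (1 / 3 : ℝ) < 1 by norm_num)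
  obtain ⟨t, ht⟩ := exists_height_add p
  have h1 := (tendsto_height_topIndex_sub hk r).const_div_atTop ((carry α (r + p) + M * t : ℕ) : ℝ)
  filter_upwards [eventually_eq_lead_mul_add hk hα (r + p),
    h1.eventually_lt_const (half_pos hε)] with j hj hj'
  obtain ⟨hrp, hj⟩ := hj
  set N := topIndex (k j) - r
  have hN : topIndex (k j) - (r + p) = N - p := by omega
  have hlt := greedyRem_succ_lt (k j) (r + p)
  have hNp := ht (N - p)
  rw [show N - p + p = N by omega] at hNp
  rw [hN] at hj hlt
  have h0 : (0 : ℝ) < height N := by exact_mod_cast height_pos N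
  have habs : |((k j : ℤ) - M * height N : ℤ)| ≤ height (N - p) + (carry α (r + p) + M * t : ℕ) := by
    have h2 : (lead α (r + p) : ℤ) = 3 ^ p * M - e := by
      have := hM p; zify at this; linarith
    have h3 : ((k j : ℤ) - M * height N : ℤ) =
        greedyRem (k j) (r + p + 1) + carry α (r + p) - M * t - e * height (N - p) := by
      conv_lhs => rw [hj, hNp]
      push_cast
      rw [h2]; ring
    have h4 : (e : ℤ) * height (N - p) ≤ height (N - p) :=
      mul_le_of_le_one_left (by positivity) (by exact_mod_cast he)
    have h5 : (0 : ℤ) ≤ e * height (N - p) := by positivity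
    have h6 : (0 : ℤ) ≤ M * t := by positivity
    rw [h3]
    push_cast
    rw [abs_le]
    constructor <;> linarith
  have habs' : |(((k j : ℤ) - M * height N : ℤ) : ℝ)| ≤
      height (N - p) + (carry α (r + p) + M * t : ℕ) := by exact_mod_cast habs
  have hp' : (height (N - p) : ℝ) ≤ (1 / 3) ^ p * height N := by
    rw [hNp]
    push_cast
    rw [mul_add, ← mul_assoc, ← mul_pow]
    norm_num
  rw [Real.norm_of_nonneg (by positivity), div_lt_iff₀ h0]
  rw [div_lt_iff₀ h0] at hj'
  have hp'' := mul_lt_mul_of_pos_right hp h0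
  linarith

end Limits

/-! ### The two kinds of weak limits -/

section WeakLimits

variable {X : Type*} [MeasurableSpace X] {μ : Measure X} {T : X ≃ᵐ X}

theorem isWeakLimit_iff (hT : MeasurePreserving T μ μ) (k : ℕ → ℤ)
    (L : Lp ℂ 2 μ →L[ℂ] Lp ℂ 2 μ) : IsWeakLimit T hT k L ↔
      ∀ f g, Tendsto (fun j => inner ℂ g (koopmanPow T hT (-k j) f)) atTop
        (𝓝 (inner ℂ g (L f))) :=
  ContinuousLinearMapWOT.tendsto_iff_forall_inner_apply_tendsto

namespace IsTowers

variable [IsProbabilityMeasure μ] {E : ℕ → Set X}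

/-- If `q j` is negligible with respect to the height of Tower `N j`, then
`T̂ ^ (-(q j + m * height (N j))) - P m T̂ * T̂ ^ (-q j)` tends weakly to `0`. -/
theorem tendsto_inner_koopmanPow_sub (h : IsTowers T μ E) {N : ℕ → ℕ} (hN : Tendsto N atTop atTop)
    (m : ℕ) {q : ℕ → ℤ} (hq : Tendsto (fun j => |(q j : ℝ)| / height (N j)) atTop (𝓝 0))
    (f g : Lp ℂ 2 μ) :
    Tendsto (fun j => inner ℂ g ((koopmanPow T h.measurePreserving (-(q j + m * height (N j))) -
      aeval (koopmanPow T h.measurePreserving 1) (P m) *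
        koopmanPow T h.measurePreserving (-q j)) f)) atTop (𝓝 0) := by
  refine tendsto_inner_zero_of_total (K := 2) (fun j => ?_) h.topologicalClosure_span_levelVecs
    ?_ f g
  · refine (norm_sub_le _ _).trans ?_
    have h1 := norm_koopmanPow_le h.measurePreserving (-(q j + m * height (N j)))
    have h2 := (norm_mul_le (aeval (koopmanPow T h.measurePreserving 1) (P m))
      (koopmanPow T h.measurePreserving (-q j))).trans
      (mul_le_one₀ (norm_aeval_P_le h.measurePreserving m) (norm_nonneg _)
        (norm_koopmanPow_le h.measurePreserving (-q j)))
    linarith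
  · rintro _ ⟨n, J, hJ, rfl⟩ _ ⟨n', J', hJ', rfl⟩
    have hh : Tendsto (fun j => (height (N j) : ℝ)) atTop atTop :=
      tendsto_natCast_atTop_atTop.comp (height_strictMono.tendsto_atTop.comp hN)
    have hb : Tendsto (fun j => ‖h.vec n' J'‖ * (2 * √((m + |(q j : ℝ)|) / height (N j)))) atTop
        (𝓝 0) := by
      have h1 := (hh.const_div_atTop (m : ℝ)).add hq
      have h2 := (((Real.continuous_sqrt.tendsto _).comp h1).const_mul 2).const_mul ‖h.vec n' J'‖
      simpa [Function.comp_def, add_div] using h2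
    refine squeeze_zero_norm' ?_ hb
    filter_upwards [tendsto_atTop.1 hN n, tendsto_atTop.1 hN n'] with j hj hj'
    obtain ⟨I, hI, e⟩ := h.exists_vec_eq hj hJ
    obtain ⟨I', hI', e'⟩ := h.exists_vec_eq hj' hJ'
    rw [e, e']
    exact h.norm_inner_koopmanPow_sub_le hI (h.vec_mem_levelSpan hI')

theorem eventually_mem_levelSpan (h : IsTowers T μ E) {g : Lp ℂ 2 μ}
    (hg : g ∈ Submodule.span ℂ h.levelVecs) : ∀ᶠ n in atTop, g ∈ h.levelSpan n := by
  induction hg using Submodule.span_induction with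
  | zero => exact Eventually.of_forall fun n => Submodule.zero_mem _
  | add f g _ _ hf hg =>
    filter_upwards [hf, hg] with n hf hg
    exact Submodule.add_mem _ hf hg
  | smul c f _ hf =>
    filter_upwards [hf] with n hf
    exact Submodule.smul_mem _ _ hf
  | mem g hg =>
    obtain ⟨n, J, hJ, rfl⟩ := hg
    filter_upwards [eventually_ge_atTop n] with N hN
    obtain ⟨J', hJ', e⟩ := h.exists_vec_eq hN hJ
    rw [e]
    exact h.vec_mem_levelSpan hJ'

variable {k : ℕ → ℕ} {α : ℕ → ℕ} {L : Lp ℂ 2 μ →L[ℂ] Lp ℂ 2 μ}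

/-- A factorization of the limit when the digits are eventually all `0` (`e = 0`) or all `2`
(`e = 1`); the operator `L'` is a limit along a subsequence of the powers of exponent
`-(k j - M * height (topIndex (k j) - r))`. -/
theorem exists_eq_aeval_mul [TopologicalSpace.SeparableSpace (Lp ℂ 2 μ)] (h : IsTowers T μ E)
    (hk : Tendsto k atTop atTop)
    (hL : IsWeakLimit T h.measurePreserving (fun j => (k j : ℤ)) L)
    (hα : ∀ l, Tendsto (fun j => greedyDigit (k j) l) atTop (𝓝 (α l))) {r M e : ℕ} (he : e ≤ 1)
    (hM : ∀ p, lead α (r + p) + e = 3 ^ p * M) :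
    ∃ (k' : ℕ → ℤ) (L' : Lp ℂ 2 μ →L[ℂ] Lp ℂ 2 μ), IsWeakLimit T h.measurePreserving k' L' ∧
      L = aeval (koopmanPow T h.measurePreserving 1) (P M) * L' := by
  rw [isWeakLimit_iff] at hL
  set N : ℕ → ℕ := fun j => topIndex (k j) - r
  have hN : Tendsto N atTop atTop := (tendsto_sub_atTop_nat r).comp (tendsto_topIndex hk)
  set q : ℕ → ℤ := fun j => (k j : ℤ) - M * height (N j) with hq
  have hdiff := h.tendsto_inner_koopmanPow_sub hN M (q := q)
    (tendsto_sub_div_height hk hα he hM)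
  have hkq : ∀ j, q j + M * height (N j) = k j := fun j => by rw [hq]; ring
  simp only [hkq] at hdiff
  obtain ⟨ψ, L', hψ, hL'⟩ := exists_subseq_weak_tendsto
    (A := fun j => koopmanPow T h.measurePreserving (-q j)) fun j => norm_koopmanPow_le _ _
  refine ⟨q ∘ ψ, L', (isWeakLimit_iff _ _ _).2 hL', ?_⟩
  refine ContinuousLinearMap.ext fun f => ext_inner_left ℂ fun g => ?_
  have h1 := (hL f g).comp hψ.tendsto_atTop
  have h2 := (hdiff f g).comp hψ.tendsto_atTop
  have h3 := hL' f ((aeval (koopmanPow T h.measurePreserving 1) (P M)).adjoint g)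
  have h4 := h2.add h3
  rw [ContinuousLinearMap.adjoint_inner_left, zero_add] at h4
  refine tendsto_nhds_unique h1 (h4.congr fun j => ?_)
  simp only [Function.comp_apply, ContinuousLinearMap.adjoint_inner_left, sub_apply,
    inner_sub_right]
  exact sub_add_cancel _ _

/-- The weak limit inherits the splitting of the levels of Tower `topIndex (k j) - r`, for each
`r`. -/
theorem norm_inner_limit_le (h : IsTowers T μ E) (hk : Tendsto k atTop atTop)
    (hL : IsWeakLimit T h.measurePreserving (fun j => (k j : ℤ)) L)
    (hα : ∀ l, Tendsto (fun j => greedyDigit (k j) l) atTop (𝓝 (α l))) (r : ℕ) {f : Lp ℂ 2 μ}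
    (hf : f ∈ h.levelVecs) (g : Lp ℂ 2 μ) :
    ‖inner ℂ g (L f)‖ ≤
      ‖(aeval (koopmanPow T h.measurePreserving 1) (P (lead α r))).adjoint g‖ +
      ‖(aeval (koopmanPow T h.measurePreserving 1) (P (lead α r + 1))).adjoint g‖ := by
  rw [isWeakLimit_iff] at hL
  have hcl : IsClosed {g : Lp ℂ 2 μ | ‖inner ℂ g (L f)‖ ≤
      ‖(aeval (koopmanPow T h.measurePreserving 1) (P (lead α r))).adjoint g‖ +
      ‖(aeval (koopmanPow T h.measurePreserving 1) (P (lead α r + 1))).adjoint g‖} :=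
    isClosed_le (by fun_prop) (by fun_prop)
  have hg : g ∈ (Submodule.span ℂ h.levelVecs).topologicalClosure :=
    h.topologicalClosure_span_levelVecs ▸ Submodule.mem_top
  refine closure_minimal (fun g hg => ?_) hcl hg
  obtain ⟨n, J, hJ, rfl⟩ := hf
  set N : ℕ → ℕ := fun j => topIndex (k j) - r
  have hN : Tendsto N atTop atTop := (tendsto_sub_atTop_nat r).comp (tendsto_topIndex hk)
  have h1 := (tendsto_height_topIndex_sub hk r).const_div_atTop
    (2 * lead α r + 1 + carry α r : ℝ)
  have h2 := (((Real.continuous_sqrt.tendsto _).comp h1).const_mul ‖g‖).const_add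
    (‖(aeval (koopmanPow T h.measurePreserving 1) (P (lead α r))).adjoint g‖ +
      ‖(aeval (koopmanPow T h.measurePreserving 1) (P (lead α r + 1))).adjoint g‖)
  rw [Real.sqrt_zero, mul_zero, add_zero] at h2
  refine le_of_tendsto_of_tendsto (hL _ g).norm h2 ?_
  filter_upwards [eventually_eq_lead_mul_add hk hα r, tendsto_atTop.1 hN n,
    hN.eventually (h.eventually_mem_levelSpan hg)] with j hj hnj hgj
  obtain ⟨I, hI, e⟩ := h.exists_vec_eq hnj hJ
  have hlt : greedyRem (k j) (r + 1) < height (N j) := greedyRem_succ_lt (k j) r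
  have hkj : (k j : ℤ) = (carry α r + greedyRem (k j) (r + 1) : ℕ) +
      (lead α r : ℕ) * height (N j) := by
    have := hj.2
    zify at this
    push_cast
    linarith
  rw [e, hkj]
  exact h.norm_inner_koopmanPow_le (Nat.cast_nonneg _) (by push_cast; omega) hI hgj

/-- If the digits differ from `0` infinitely often and from `2` infinitely often, the limit is the
projector onto the constants. -/
theorem eq_theta (h : IsTowers T μ E) (hk : Tendsto k atTop atTop)
    (hL : IsWeakLimit T h.measurePreserving (fun j => (k j : ℤ)) L)
    (hα : ∀ l, Tendsto (fun j => greedyDigit (k j) l) atTop (𝓝 (α l)))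
    (h2 : {l | α l ≠ 2}.Infinite) (h0 : {l | α l ≠ 0}.Infinite) : L = theta μ := by
  set e : Lp ℂ 2 μ := Lp.const 2 μ (1 : ℂ) with he
  have hee : inner ℂ e e = 1 := by rw [inner_self_eq_norm_sq_to_K, norm_const]; simp
  have hα2 := limit_digit_le_two hα h0
  have hU := koopmanPow_one_mem_unitary h.measurePreserving
  -- the range of `L` consists of constants
  have horth : ∀ g, inner ℂ g e = 0 → ∀ f, inner ℂ g (L f) = 0 := by
    intro g hg f
    have hdecay := fun ε (hε : ε > 0) =>
      eventually_norm_one_sub_mul_eval_P_lead_le hα2 h2 h0 hε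
    have t1 := tendsto_adjoint_aeval hU (p := fun n => P (lead α n))
      (fun n z hz => norm_eval_P_le _ hz)
      (fun ε hε => (hdecay ε hε).mono fun n hn z hz => (hn z hz).1) (h.mem_orthogonal_ker hg)
    have t2 := tendsto_adjoint_aeval hU (p := fun n => P (lead α n + 1))
      (fun n z hz => norm_eval_P_le _ hz)
      (fun ε hε => (hdecay ε hε).mono fun n hn z hz => (hn z hz).2) (h.mem_orthogonal_ker hg)
    have t3 := t1.norm.add t2.norm
    rw [norm_zero, add_zero] at t3
    have hlev : ∀ f ∈ h.levelVecs, inner ℂ g (L f) = 0 := fun f hf =>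
      norm_le_zero_iff.1 (ge_of_tendsto' t3 fun r => h.norm_inner_limit_le hk hL hα r hf g)
    have hle : Submodule.span ℂ h.levelVecs ≤ ((innerSL ℂ g).comp L).ker :=
      Submodule.span_le.2 fun f hf => hlev f hf
    have hle' := Submodule.topologicalClosure_minimal _ hle
      (ContinuousLinearMap.isClosed_ker ((innerSL ℂ g).comp L))
    rw [h.topologicalClosure_span_levelVecs] at hle'
    exact hle' Submodule.mem_top
  -- `L` preserves the integral
  have hint : ∀ f, inner ℂ e (L f) = inner ℂ e f := by
    intro f
    refine tendsto_nhds_unique ((isWeakLimit_iff _ _ _).1 hL f e)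
      (tendsto_const_nhds.congr fun j => ?_)
    conv_rhs => rw [he, ← koopmanPow_const h.measurePreserving (-(k j : ℤ))]
    exact ((koopman T h.measurePreserving ^ (-(k j : ℤ))).inner_map_map e f).symm
  refine ContinuousLinearMap.ext fun f => ?_
  have htheta : theta μ f = inner ℂ e f • e :=
    Submodule.starProjection_unit_singleton ℂ norm_const f
  rw [htheta, ← hint, ← sub_eq_zero, ← @inner_self_eq_zero ℂ]
  have hperp : inner ℂ (L f - inner ℂ e (L f) • e) e = 0 := by
    rw [inner_sub_left, inner_smul_left, hee, inner_conj_symm, mul_one, sub_self]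
  rw [inner_sub_right, horth _ hperp, inner_smul_right, hperp, mul_zero, sub_zero]

end IsTowers

end WeakLimits

end Chacon

theorem mainTheorem3 {X : Type*} [MeasurableSpace X] [StandardBorelSpace X]
    (μ : Measure X) [IsProbabilityMeasure μ] (T : X ≃ᵐ X) (hT : Chacon.IsChacon T μ)
    (L : Lp ℂ 2 μ →L[ℂ] Lp ℂ 2 μ) (k : ℕ → ℕ) (hk_pos : ∀ j, 0 < k j)
    (hk : Tendsto k atTop atTop)
    (hL : Chacon.IsWeakLimit T hT.measurePreserving (fun j => (k j : ℤ)) L)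
    (α : ℕ → ℕ) (hα : ∀ l, Tendsto (fun j => Chacon.greedyDigit (k j) l) atTop (𝓝 (α l))) :
    ((∃ r, (∀ l > r, α l = 2) ∨ (∀ l > r, α l = 0)) →
      ∃ m ≥ 1, ∃ (k' : ℕ → ℤ) (L' : Lp ℂ 2 μ →L[ℂ] Lp ℂ 2 μ),
        Chacon.IsWeakLimit T hT.measurePreserving k' L' ∧
        L = aeval (Chacon.koopmanPow T hT.measurePreserving 1) (Chacon.P m) * L') ∧
    ({l | α l ≠ 2}.Infinite → {l | α l ≠ 0}.Infinite → L = Chacon.theta μ) := by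
  obtain ⟨E, hE⟩ := hT.exists_isTowers
  have : Fact ((2 : ENNReal) ≠ ⊤) := ⟨by simp⟩
  have : TopologicalSpace.SeparableSpace (Lp ℂ 2 μ) := inferInstance
  refine ⟨?_, fun h2 h0 => hE.eq_theta hk hL hα h2 h0⟩
  rintro ⟨r, hr | hr⟩
  · exact ⟨Chacon.lead α r + 1, by omega, hE.exists_eq_aeval_mul hk hL hα (r := r) (e := 1) le_rfl
      (Chacon.lead_add_of_eq_two hr)⟩
  · exact ⟨Chacon.lead α r, (Chacon.one_le_limit_digit_zero hk_pos hα).trans (Chacon.le_lead α r),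
      hE.exists_eq_aeval_mul hk hL hα (r := r) (e := 0) zero_le_one
        (Chacon.lead_add_of_eq_zero hr)⟩
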